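/- Let $\zeta$ be a transcendental real number. For $n\geq 1$ let $w_n(\zeta)\in[-\infty,\infty]$ be the supremum of the real numbers $w$ such that $0<|P(\zeta)|\leq H(P)^{-w}$ has infinitely many solutions $P\in\mathbb{Z}[T]$ of degree at most $n$, where $H(P)$ is the maximum modulus of the coefficients of $P$. Let $\lambda_n(\zeta)\in[-\infty,\infty]$ be the supremum of the real numbers $\lambda$ such that the system $$1\leq |x|\leq X,\qquad \max_{1\leq i\leq n}|\zeta^i x-y_i|\leq X^{-\lambda}$$ has a solution $(x,y_1,\ldots,y_n)\in\mathbb{Z}^{n+1}$ for arbitrarily large real $X$. For an integer $m\geq 1$, $\zeta$ is a $U_m$-number if $m$ is the smallest index with $w_m(\zeta)=\infty$, and a $U$-number if it is a $U_m$-number for some $m\geq 1$; $\zeta$ is a $T$-number if $w_n(\zeta)<\infty$ for all $n\geq 1$ and $\limsup_{n\to\infty} w_n(\zeta)/n=\infty$; and $\zeta$ is an $S$-number if the sequence $(w_n(\zeta)/n)_{n\geq 1}$ is bounded above by a real constant. **Theorem 2.1 (Equivalence principle I).** The following hold. 1. $\zeta$ is a $U$-number if and only if $\lim_{n\to\infty}\lambda_n(\zeta)$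 exists in $[-\infty,\infty]$ and is $>0$ (possibly $\infty$). 2. If $\zeta$ is a $U_m$-number, then $\lambda_n(\zeta)=\frac{1}{m-1}$ for all sufficiently large $n$, where $1/0=\infty$. 3. $\zeta$ is a $T$-number if and only if $\lim_{n\to\infty}\lambda_n(\zeta)=0$ and $\limsup_{n\to\infty} n\lambda_n(\zeta)=\infty$. 4. $\zeta$ is an $S$-number if and only if $\limsup_{n\to\infty} n\lambda_n(\zeta)<\infty$. -/

import Mathlib

open Filter Topology

/-- The height `H(P)` of an integer polynomial: the maximum modulus of its coefficients. -/
def polyHeight (P : Polynomial ℤ) : ℕ :=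
  P.support.sup fun i => (P.coeff i).natAbs

/-- The exponent `w_n(ζ)`: the supremum in `[-∞, ∞]` of the real numbers `w` such that
`0 < |P(ζ)| ≤ H(P)^(-w)` has infinitely many solutions `P ∈ ℤ[T]` of degree at most `n`. -/
noncomputable def wExp (n : ℕ) (ζ : ℝ) : EReal :=
  sSup ((fun w : ℝ => (w : EReal)) ''
    {w : ℝ | {P : Polynomial ℤ | P.natDegree ≤ n ∧ 0 < |Polynomial.aeval ζ P| ∧
      |Polynomial.aeval ζ P| ≤ (polyHeight P : ℝ) ^ (-w)}.Infinite})

/-- The exponent `λ_n(ζ)`: the supremum in `[-∞, ∞]` of the real numbers `l` such that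
`1 ≤ |x| ≤ X`, `max_{1 ≤ i ≤ n} |ζ^i x - y_i| ≤ X^(-l)` has an integer solution
`(x, y_1, …, y_n)` for arbitrarily large `X` (the index `i : Fin n` stands for `i + 1`). -/
noncomputable def lambdaExp (n : ℕ) (ζ : ℝ) : EReal :=
  sSup ((fun l : ℝ => (l : EReal)) ''
    {l : ℝ | ∀ X₀ : ℝ, ∃ X : ℝ, X₀ ≤ X ∧ ∃ (x : ℤ) (y : Fin n → ℤ),
      1 ≤ |x| ∧ (|x| : ℝ) ≤ X ∧
        ∀ i : Fin n, |ζ ^ ((i : ℕ) + 1) * (x : ℝ) - (y i : ℝ)| ≤ X ^ (-l)})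

/-- `ζ` is a `U_m`-number: `m ≥ 1` is the smallest index with `w_m(ζ) = ∞`. -/
def IsUNumberOfType (m : ℕ) (ζ : ℝ) : Prop :=
  Transcendental ℚ ζ ∧ 1 ≤ m ∧ wExp m ζ = ⊤ ∧ ∀ k : ℕ, 1 ≤ k → k < m → wExp k ζ ≠ ⊤

/-- `ζ` is a `U`-number. -/
def IsUNumber (ζ : ℝ) : Prop :=
  ∃ m : ℕ, IsUNumberOfType m ζ

/-- `ζ` is a `T`-number: all `w_n(ζ)`, `n ≥ 1`, are finite, but `limsup w_n(ζ)/n = ∞`. -/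
def IsTNumber (ζ : ℝ) : Prop :=
  Transcendental ℚ ζ ∧ (∀ n : ℕ, 1 ≤ n → wExp n ζ < ⊤) ∧
    limsup (fun n : ℕ => wExp n ζ / (n : EReal)) atTop = ⊤

/-- `ζ` is an `S`-number: `w_n(ζ)/n` is bounded over `n ≥ 1`. -/
def IsSNumber (ζ : ℝ) : Prop :=
  Transcendental ℚ ζ ∧ ∃ C : ℝ, ∀ n : ℕ, 1 ≤ n → wExp n ζ / (n : EReal) ≤ (C : EReal)

/-!
Both sequences of exponents are compared through linear recurrences. An integer vector
`(x, y_1, …, y_N)` close to `x (1, ζ, …, ζ ^ N)`, with `y_0 = x`, is viewed as the functional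
`T ^ i ↦ y_i` on polynomials of degree at most `N`; it maps a polynomial `R` of moderate height to
an integer close to `x R(ζ)`. A polynomial `P` is annihilated together with its shifts `T ^ j P`
exactly when `(y_i)` satisfies the linear recurrence with coefficients those of `P`.

*Lower bounds for `λ_N`.* Given `P` of degree `d` with a tiny value at `ζ`, the pigeonhole principle
produces a vector satisfying the recurrence of `P` exactly and having small errors in a few
coordinates (`exists_recurrence_approx`); the recurrence carries the smallness to the others. This
gives `λ_N ≥ 1 / (m - 1)` for all `N ≥ m` if `w_m = ∞` (`le_lambdaExp_of_wExp_eq_top`), and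
`λ_{(a + 1) n} ≥ 1 / (4 n)` if `w_n > (3 a + 1) n` (`le_lambdaExp_of_lt_wExp`).

*Upper bounds for `λ_N`.* Suppose that `λ_N > 1 / k`. By the pigeonhole principle a good vector is
annihilated by some nonzero polynomial of degree at most `k`, and all annihilating polynomials of
moderate degree and height are multiples of one polynomial `G` of degree at most `k`
(`exists_dvd_of_forall_shift_eq_zero`). Since `G` annihilates the vector, `G(ζ)` is small compared
with `x`, so that finiteness of `w_k` forces the height of `G` to be at least a fixed power of `x`.
By Gelfond's lemma `G` then has fewer multiples in a box than the pigeonhole principle provides, if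
the degree is large in terms of `k` and `w_k`. The outcome is `λ_N ≤ 1 / k` whenever `N ≥ 3 k + w`
for an integer `w > w_k` (`lambdaExp_le_of_wExp_lt`).

If `w_m = ∞` with `m` minimal, the first lower bound and the upper bound with `k = m - 1` determine
`λ_N` for large `N`. If all `w_k` are finite, then `λ_N → 0`; and `w_n = O(n)` is equivalent to
`λ_N = O(1 / N)` by the upper bound and the second lower bound.
-/

/-! ### Heights of integer polynomials -/

theorem natAbs_coeff_le_polyHeight (P : Polynomial ℤ) (i : ℕ) :
    (P.coeff i).natAbs ≤ polyHeight P := by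
  by_cases h : i ∈ P.support
  · exact Finset.le_sup (f := fun i => (P.coeff i).natAbs) h
  · simp [Polynomial.notMem_support_iff.mp h]

theorem abs_coeff_le_polyHeight (P : Polynomial ℤ) (i : ℕ) :
    |(P.coeff i : ℝ)| ≤ polyHeight P := by
  rw [← Int.cast_abs, Int.abs_eq_natAbs]
  exact_mod_cast natAbs_coeff_le_polyHeight P i

theorem polyHeight_le {P : Polynomial ℤ} {B : ℕ} (h : ∀ i, (P.coeff i).natAbs ≤ B) :
    polyHeight P ≤ B :=
  Finset.sup_le fun i _ => h i

theorem one_le_polyHeight {P : Polynomial ℤ} (hP : P ≠ 0) : 1 ≤ polyHeight P := by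
  refine le_trans ?_ (natAbs_coeff_le_polyHeight P P.natDegree)
  have : P.coeff P.natDegree ≠ 0 := Polynomial.leadingCoeff_ne_zero.mpr hP
  omega

theorem exists_coeff_eq_polyHeight (P : Polynomial ℤ) :
    ∃ i, |(P.coeff i : ℝ)| = polyHeight P := by
  by_cases hP : P = 0
  · exact ⟨0, by simp [hP, polyHeight]⟩
  · obtain ⟨i, -, hi⟩ := Finset.exists_mem_eq_sup P.support
      (Polynomial.support_nonempty.mpr hP) (fun i => (P.coeff i).natAbs)
    refine ⟨i, ?_⟩
    rw [polyHeight, hi, ← Int.cast_abs, Int.abs_eq_natAbs]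
    simp

theorem finite_natDegree_le_polyHeight_le (n B : ℕ) :
    {P : Polynomial ℤ | P.natDegree ≤ n ∧ polyHeight P ≤ B}.Finite := by
  refine Set.Finite.of_finite_image (f := fun P (i : Fin (n + 1)) => P.coeff i)
    ((Set.finite_Icc (fun _ => -(B : ℤ)) (fun _ => (B : ℤ))).subset ?_) ?_
  · rintro _ ⟨P, ⟨-, hP⟩, rfl⟩
    constructor <;> intro i <;> have := natAbs_coeff_le_polyHeight P i <;> simp only <;> omega
  · rintro P ⟨hP, -⟩ Q ⟨hQ, -⟩ h
    ext i
    rcases le_or_gt i n with hi | hi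
    · exact congrFun h ⟨i, by omega⟩
    · rw [Polynomial.coeff_eq_zero_of_natDegree_lt (by omega),
        Polynomial.coeff_eq_zero_of_natDegree_lt (by omega)]

/-- The height is comparable with the multiplicative Mahler measure: upper bound. -/
theorem polyHeight_le_mahlerMeasure {n : ℕ} {P : Polynomial ℤ} (hP : P.natDegree ≤ n) :
    (polyHeight P : ℝ) ≤ 2 ^ n * (P.map (Int.castRingHom ℂ)).mahlerMeasure := by
  obtain ⟨i, hi⟩ := exists_coeff_eq_polyHeight P
  have h := (P.map (Int.castRingHom ℂ)).norm_coeff_le_choose_mul_mahlerMeasure i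
  rw [Polynomial.coeff_map, eq_intCast, Complex.norm_intCast, hi] at h
  refine h.trans (mul_le_mul_of_nonneg_right ?_ (Polynomial.mahlerMeasure_nonneg _))
  rw [Polynomial.natDegree_map_eq_of_injective (RingHom.injective_int _)]
  calc ((P.natDegree.choose i : ℕ) : ℝ) ≤ ((2 ^ P.natDegree : ℕ) : ℝ) := by
        exact_mod_cast Nat.choose_le_two_pow _ _
    _ ≤ 2 ^ n := by push_cast; exact pow_le_pow_right₀ (by norm_num) hP

theorem mahlerMeasure_le_polyHeight {n : ℕ} {P : Polynomial ℤ} (hP : P.natDegree ≤ n) :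
    (P.map (Int.castRingHom ℂ)).mahlerMeasure ≤ (n + 1) * polyHeight P := by
  refine (Polynomial.mahlerMeasure_le_sum_norm_coeff _).trans ?_
  rw [Polynomial.sum_over_range' _ (by simp) (n + 1)
    (lt_of_le_of_lt Polynomial.natDegree_map_le (by omega))]
  refine (Finset.sum_le_card_nsmul _ _ (polyHeight P : ℝ) fun i _ => ?_).trans (by simp)
  rw [Polynomial.coeff_map, eq_intCast, Complex.norm_intCast]
  exact abs_coeff_le_polyHeight P i

/-- Gelfond's lemma: in bounded degree, the height is multiplicative up to a constant. -/
theorem polyHeight_mul_polyHeight_le {n : ℕ} {P Q : Polynomial ℤ} (h0 : P * Q ≠ 0)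
    (hPQ : (P * Q).natDegree ≤ n) :
    (polyHeight P : ℝ) * polyHeight Q ≤ 4 ^ n * (n + 1) * polyHeight (P * Q) := by
  have hdeg := Polynomial.natDegree_mul (left_ne_zero_of_mul h0) (right_ne_zero_of_mul h0)
  have h1 := polyHeight_le_mahlerMeasure (n := n) (P := P) (by omega)
  have h2 := polyHeight_le_mahlerMeasure (n := n) (P := Q) (by omega)
  have h3 := mahlerMeasure_le_polyHeight hPQ
  rw [Polynomial.map_mul, Polynomial.mahlerMeasure_mul] at h3
  calc (polyHeight P : ℝ) * polyHeight Q
      ≤ (2 ^ n * (P.map (Int.castRingHom ℂ)).mahlerMeasure) *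
          (2 ^ n * (Q.map (Int.castRingHom ℂ)).mahlerMeasure) :=
        mul_le_mul h1 h2 (Nat.cast_nonneg _) ((Nat.cast_nonneg _).trans h1)
    _ = 4 ^ n * ((P.map (Int.castRingHom ℂ)).mahlerMeasure *
          (Q.map (Int.castRingHom ℂ)).mahlerMeasure) := by
        rw [show (4 : ℝ) = 2 * 2 by norm_num, mul_pow]; ring
    _ ≤ 4 ^ n * ((n + 1) * polyHeight (P * Q)) := by gcongr
    _ = _ := by ring

/-- A polynomial of degree at most `n` takes a value comparable with its height at one of the
points `0, …, n`, because evaluation at these points is an injective linear map. -/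
theorem exists_polyHeight_le_abs_eval (n : ℕ) :
    ∃ c : ℝ, 0 < c ∧ ∀ P : Polynomial ℤ, P.natDegree ≤ n →
      ∃ a : ℕ, a ≤ n ∧ c * polyHeight P ≤ |((P.eval (a : ℤ) : ℤ) : ℝ)| := by
  let V : Matrix (Fin (n + 1)) (Fin (n + 1)) ℝ := Matrix.vandermonde fun i => (i : ℝ)
  have hV : IsUnit V := by
    rw [Matrix.isUnit_iff_isUnit_det, isUnit_iff_ne_zero, Matrix.det_vandermonde_ne_zero_iff]
    intro i j h
    simp only [Nat.cast_inj] at h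
    exact Fin.ext h
  obtain ⟨K, hK, hanti⟩ := (Matrix.mulVecLin V).exists_antilipschitzWith
    (LinearMap.ker_eq_bot.mpr (Matrix.mulVec_injective_iff_isUnit.mpr hV))
  have hK' : (0 : ℝ) < K := by exact_mod_cast hK
  refine ⟨(K : ℝ)⁻¹, by positivity, fun P hP => ?_⟩
  let v : Fin (n + 1) → ℝ := fun i => P.coeff i
  have hval : ∀ a : Fin (n + 1), V.mulVec v a = ((P.eval ((a : ℕ) : ℤ) : ℤ) : ℝ) := by
    intro a
    rw [Polynomial.eval_eq_sum_range' (Nat.lt_succ_of_le hP), ← Fin.sum_univ_eq_sum_range]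
    simp only [V, v, Matrix.mulVec, dotProduct, Matrix.vandermonde_apply]
    push_cast
    exact Finset.sum_congr rfl fun i _ => by ring
  have hnorm : ‖v‖ ≤ K * ‖V.mulVec v‖ := by
    have := hanti.le_mul_dist v 0
    simpa [dist_zero_right] using this
  obtain ⟨a, ha⟩ : ∃ a, ‖V.mulVec v a‖ = ‖V.mulVec v‖ := by
    obtain ⟨a, -, ha⟩ := Finset.exists_max_image Finset.univ (fun a => ‖V.mulVec v a‖)
      Finset.univ_nonempty
    exact ⟨a, le_antisymm (norm_le_pi_norm _ a)
      ((pi_norm_le_iff_of_nonneg (norm_nonneg _)).mpr fun b => ha b (Finset.mem_univ b))⟩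
  refine ⟨a, by omega, ?_⟩
  rw [← hval a, ← Real.norm_eq_abs, ha, inv_mul_le_iff₀ hK']
  refine le_trans ?_ hnorm
  obtain ⟨i, hi⟩ := exists_coeff_eq_polyHeight P
  rw [← hi]
  rcases le_or_gt i n with hin | hin
  · exact norm_le_pi_norm v ⟨i, by omega⟩
  · rw [Polynomial.coeff_eq_zero_of_natDegree_lt (by omega)]
    simp

theorem exists_polyHeight_taylor_le (n : ℕ) :
    ∃ C : ℕ, 1 ≤ C ∧ ∀ P : Polynomial ℤ, P.natDegree ≤ n → ∀ a : ℕ, a ≤ n →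
      polyHeight (P.taylor (a : ℤ)) ≤ C * polyHeight P := by
  let C : ℕ := ∑ a ∈ Finset.range (n + 1), ∑ k ∈ Finset.range (n + 1),
    polyHeight ((Polynomial.X + Polynomial.C (a : ℤ)) ^ k)
  refine ⟨C + 1, by omega, fun P hP a ha => polyHeight_le fun i => ?_⟩
  have hsum : P.taylor (a : ℤ) = ∑ k ∈ Finset.range (n + 1),
      Polynomial.C (P.coeff k) * (Polynomial.X + Polynomial.C (a : ℤ)) ^ k := by
    conv_lhs => rw [P.as_sum_range' (n + 1) (Nat.lt_succ_of_le hP)]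
    simp [Polynomial.taylor_monomial]
  have h1 : ((P.taylor (a : ℤ)).coeff i).natAbs ≤ ∑ k ∈ Finset.range (n + 1),
      polyHeight P * polyHeight ((Polynomial.X + Polynomial.C (a : ℤ)) ^ k) := by
    rw [hsum, Polynomial.finsetSum_coeff]
    refine (Int.natAbs_sum_le _ _).trans (Finset.sum_le_sum fun k _ => ?_)
    rw [Polynomial.coeff_C_mul, Int.natAbs_mul]
    exact Nat.mul_le_mul (natAbs_coeff_le_polyHeight _ _) (natAbs_coeff_le_polyHeight _ _)
  refine h1.trans ?_
  rw [← Finset.mul_sum, mul_comm]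
  refine Nat.mul_le_mul_right _ (Nat.le_succ_of_le ?_)
  exact Finset.single_le_sum (f := fun a : ℕ => ∑ k ∈ Finset.range (n + 1),
    polyHeight ((Polynomial.X + Polynomial.C (a : ℤ)) ^ k)) (fun _ _ => Nat.zero_le _)
    (Finset.mem_range.mpr (Nat.lt_succ_of_le ha))

theorem aeval_ne_zero_of_transcendental {ζ : ℝ} (hζ : Transcendental ℚ ζ) {P : Polynomial ℤ}
    (hP : P ≠ 0) : Polynomial.aeval ζ P ≠ 0 := by
  intro h
  have hz : Transcendental ℤ ζ := fun h' => hζ (h'.extendScalars (RingHom.injective_int (algebraMap ℤ ℚ)))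
  exact hP ((transcendental_iff.mp hz) P h)

/-- Below `w_n(ζ)` there are very small polynomial values with arbitrarily large height. -/
theorem exists_abs_aeval_le_of_lt_wExp {n : ℕ} {ζ w : ℝ} (h : (w : EReal) < wExp n ζ) (H₀ : ℕ) :
    ∃ P : Polynomial ℤ, P.natDegree ≤ n ∧ H₀ ≤ polyHeight P ∧ 1 ≤ polyHeight P ∧
      |Polynomial.aeval ζ P| ≤ (polyHeight P : ℝ) ^ (-w) := by
  obtain ⟨_, ⟨w', hw', rfl⟩, hlt⟩ := lt_sSup_iff.mp h
  have hlt' : w < w' := EReal.coe_lt_coe_iff.mp hlt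
  obtain ⟨P, ⟨hdeg, hpos, hle⟩, hnot⟩ :=
    (hw'.sdiff (finite_natDegree_le_polyHeight_le n H₀)).nonempty
  have hP : P ≠ 0 := by rintro rfl; simp at hpos
  have h1 := one_le_polyHeight hP
  refine ⟨P, hdeg, ?_, h1, hle.trans ?_⟩
  · by_contra hcon
    exact hnot ⟨hdeg, by omega⟩
  · exact Real.rpow_le_rpow_of_exponent_le (by exact_mod_cast h1) (by linarith)

/-- Above `w_n(ζ)` the polynomial values are bounded below by a power of the height. -/
theorem exists_le_abs_aeval_of_wExp_lt {n w : ℕ} {ζ : ℝ} (hζ : Transcendental ℚ ζ)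
    (h : wExp n ζ < ((w : ℝ) : EReal)) :
    ∃ c : ℝ, 0 < c ∧ ∀ P : Polynomial ℤ, P ≠ 0 → P.natDegree ≤ n →
      c ≤ |Polynomial.aeval ζ P| * (polyHeight P : ℝ) ^ w := by
  have hfin : {P : Polynomial ℤ | P.natDegree ≤ n ∧ 0 < |Polynomial.aeval ζ P| ∧
      |Polynomial.aeval ζ P| ≤ (polyHeight P : ℝ) ^ (-(w : ℝ))}.Finite := by
    by_contra hinf
    exact absurd (le_sSup (Set.mem_image_of_mem _ hinf)) (not_le.mpr h)
  let f : Polynomial ℤ → ℝ := fun P => |Polynomial.aeval ζ P| * (polyHeight P : ℝ) ^ w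
  have hpos : ∀ P : Polynomial ℤ, P ≠ 0 → 0 < f P := fun P hP =>
    mul_pos (abs_pos.mpr (aeval_ne_zero_of_transcendental hζ hP))
      (pow_pos (by exact_mod_cast one_le_polyHeight hP) _)
  obtain ⟨c, hc, hcf⟩ : ∃ c : ℝ, 0 < c ∧ ∀ P ∈ hfin.toFinset, c ≤ f P := by
    rcases hfin.toFinset.eq_empty_or_nonempty with he | hne
    · exact ⟨1, one_pos, by rw [he]; simp⟩
    · obtain ⟨P₀, hP₀, hmin⟩ := Finset.exists_min_image _ f hne
      refine ⟨f P₀, hpos P₀ ?_, hmin⟩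
      rintro rfl
      simp at hP₀
  refine ⟨min c 1, lt_min hc one_pos, fun P hP hdeg => ?_⟩
  by_cases hmem : |Polynomial.aeval ζ P| ≤ (polyHeight P : ℝ) ^ (-(w : ℝ))
  · refine (min_le_left _ _).trans (hcf P ?_)
    simp only [Set.Finite.mem_toFinset, Set.mem_ofPred_eq]
    exact ⟨hdeg, abs_pos.mpr (aeval_ne_zero_of_transcendental hζ hP), hmem⟩
  · refine (min_le_right _ _).trans ?_
    have hH : (0 : ℝ) < (polyHeight P : ℝ) ^ w :=
      pow_pos (by exact_mod_cast one_le_polyHeight hP) _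
    rw [Real.rpow_neg (by positivity), Real.rpow_natCast, not_le] at hmem
    rw [← inv_mul_cancel₀ hH.ne']
    exact mul_le_mul_of_nonneg_right hmem.le hH.le

/-! ### Lower bounds for `λ_n` -/

/-- Two families of bounded integer-valued functions on `{0, …, X}` agree at two distinct
points if `X` is at least the number of possible values. -/
theorem exists_lt_map_eq_of_abs_le {ι κ : Type*} [Fintype ι] [Fintype κ] {M D X : ℕ}
    (f : ℕ → ι → ℤ) (g : ℕ → κ → ℤ) (hf : ∀ x ≤ X, ∀ j, |f x j| ≤ M)
    (hg : ∀ x ≤ X, ∀ j, |g x j| ≤ D)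
    (hX : (2 * M + 1) ^ Fintype.card ι * (2 * D + 1) ^ Fintype.card κ ≤ X) :
    ∃ a b, a < b ∧ b ≤ X ∧ f a = f b ∧ g a = g b := by
  classical
  let T : Finset ((ι → ℤ) × (κ → ℤ)) :=
    (Fintype.piFinset fun _ => Finset.Icc (-(M : ℤ)) M) ×ˢ
      (Fintype.piFinset fun _ => Finset.Icc (-(D : ℤ)) D)
  have hT : T.card ≤ X := by
    refine le_trans (le_of_eq ?_) hX
    have h1 : ((M : ℤ) + 1 + M).toNat = 2 * M + 1 := by omega
    have h2 : ((D : ℤ) + 1 + D).toNat = 2 * D + 1 := by omega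
    simp [T, Finset.card_product, Fintype.card_piFinset, h1, h2]
  have hmaps : ∀ x ∈ Finset.range (X + 1), (f x, g x) ∈ T := by
    intro x hx
    have hx' := Finset.mem_range_succ_iff.mp hx
    simp only [T, Finset.mem_product, Fintype.mem_piFinset, Finset.mem_Icc]
    exact ⟨fun j => abs_le.mp (hf x hx' j), fun i => abs_le.mp (hg x hx' i)⟩
  obtain ⟨a, ha, b, hb, hne, hab⟩ := Finset.exists_ne_map_eq_of_card_lt_of_maps_to
    (by rw [Finset.card_range]; omega) hmaps
  rw [Finset.mem_range] at ha hb
  obtain ⟨h1, h2⟩ := Prod.mk.inj hab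
  rcases lt_or_gt_of_ne hne with h | h
  · exact ⟨a, b, h, by omega, h1, h2⟩
  · exact ⟨b, a, h, by omega, h1.symm, h2.symm⟩

theorem aeval_eq_sum_range_of_natDegree_le {θ : ℝ} {d : ℕ} {P : Polynomial ℤ}
    (hPd : P.natDegree ≤ d) :
    Polynomial.aeval θ P = ∑ k ∈ Finset.range (d + 1), (P.coeff k : ℝ) * θ ^ k := by
  rw [Polynomial.aeval_eq_sum_range' (Nat.lt_succ_of_le hPd)]
  simp

/-- Applying the coefficients of `P` to an integer vector near `(x, θ x, θ² x, …)`. -/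
theorem sum_coeff_mul_eq {θ : ℝ} {d : ℕ} {P : Polynomial ℤ} (hPd : P.natDegree ≤ d) (x : ℤ)
    (y : ℕ → ℤ) (j : ℕ) :
    ((∑ k ∈ Finset.range (d + 1), P.coeff k * y (j + k) : ℤ) : ℝ) =
      x * θ ^ j * Polynomial.aeval θ P -
        ∑ k ∈ Finset.range (d + 1), (P.coeff k : ℝ) * (θ ^ (j + k) * x - y (j + k)) := by
  rw [aeval_eq_sum_range_of_natDegree_le hPd, Finset.mul_sum, ← Finset.sum_sub_distrib]
  push_cast
  exact Finset.sum_congr rfl fun k _ => by ring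

theorem abs_mul_pow_mul_aeval_le {θ A : ℝ} {N j X : ℕ} {x : ℤ} {P : Polynomial ℤ} (hA : 1 ≤ A)
    (hθ : |θ| ≤ A) (hj : j ≤ N) (hx0 : 0 ≤ x) (hx : x ≤ X) :
    |(x : ℝ) * θ ^ j * Polynomial.aeval θ P| ≤ X * A ^ N * |Polynomial.aeval θ P| := by
  rw [abs_mul, abs_mul, abs_pow, abs_of_nonneg (by exact_mod_cast hx0)]
  have h1 : |θ| ^ j ≤ A ^ N := (pow_le_pow_left₀ (abs_nonneg _) hθ j).trans
    (pow_le_pow_right₀ hA hj)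
  have h2 : (x : ℝ) ≤ X := by exact_mod_cast hx
  gcongr

theorem abs_sum_mul_le {n : ℕ} {H ε : ℝ} {c e : ℕ → ℝ} (hH : 0 ≤ H) (hc : ∀ k, |c k| ≤ H)
    (he : ∀ k < n, |e k| ≤ ε) : |∑ k ∈ Finset.range n, c k * e k| ≤ n * (H * ε) := by
  refine (Finset.abs_sum_le_sum_abs _ _).trans
    ((Finset.sum_le_card_nsmul _ _ (H * ε : ℝ) fun k hk => ?_).trans (by simp))
  rw [abs_mul]
  exact mul_le_mul (hc k) (he k (Finset.mem_range.mp hk)) (abs_nonneg _) hH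

/-- Pigeonhole: given a polynomial `P` with a tiny value at `θ`, some integer vector
`(x, y_1, …, y_N)` satisfies exactly the linear recurrence with coefficients those of `P`, while
finitely many prescribed coordinates `y_i` are close to `θ ^ i x`. -/
theorem exists_recurrence_approx {θ A : ℝ} {N d H D X : ℕ} {P : Polynomial ℤ} (S : Finset ℕ)
    (hA : 1 ≤ A) (hθ : |θ| ≤ A) (hPd : P.natDegree ≤ d) (hPH : polyHeight P ≤ H)
    (hD : 1 ≤ D)
    (hX : (2 * ((d + 1) * H + 1) + 1) ^ (N + 1 - d) * (2 * D + 1) ^ S.card ≤ X)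
    (hsmall : X * A ^ N * |Polynomial.aeval θ P| ≤ 1) :
    ∃ (x : ℤ) (y : ℕ → ℤ), 1 ≤ x ∧ x ≤ X ∧ y 0 = x ∧
      (∀ j, j + d ≤ N → ∑ k ∈ Finset.range (d + 1), P.coeff k * y (j + k) = 0) ∧
      ∀ i ∈ S, |θ ^ i * x - y i| ≤ 1 / D := by
  have hDpos : (0 : ℝ) < D := by exact_mod_cast hD
  let z : ℕ → ℕ → ℤ := fun x i => round (θ ^ i * x)
  let L : ℕ → ℕ → ℤ := fun x j => ∑ k ∈ Finset.range (d + 1), P.coeff k * z x (j + k)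
  let E : ℕ → ℕ → ℤ := fun x i => ⌊D * (θ ^ i * x - z x i)⌋
  have hz : ∀ (x : ℕ) (i : ℕ), |θ ^ i * (x : ℝ) - z x i| ≤ 1 / 2 := fun x i => abs_sub_round _
  have hL : ∀ x ≤ X, ∀ j, j + d ≤ N → |L x j| ≤ ((d + 1) * H + 1 : ℕ) := by
    intro x hx j hj
    have h1 := abs_mul_pow_mul_aeval_le (P := P) hA hθ (by omega : j ≤ N) (Int.natCast_nonneg x)
      (Int.ofNat_le.mpr hx)
    have h2 := abs_sum_mul_le (n := d + 1) (Nat.cast_nonneg H)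
      (fun k => (abs_coeff_le_polyHeight P k).trans (by exact_mod_cast hPH))
      (e := fun k => θ ^ (j + k) * ((x : ℤ) : ℝ) - z x (j + k)) (ε := 1) fun k _ => by
        have := hz x (j + k)
        simp only [Int.cast_natCast]
        linarith
    have h3 : |(L x j : ℝ)| ≤ (((d + 1) * H + 1 : ℕ) : ℝ) := by
      rw [sum_coeff_mul_eq hPd x (z x) j]
      push_cast
      refine (abs_sub _ _).trans ?_
      push_cast at h1 h2
      linarith
    exact_mod_cast h3
  have hE : ∀ x i, |E x i| ≤ (D : ℤ) := by
    intro x i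
    obtain ⟨h1, h2⟩ := abs_le.mp (hz x i)
    rw [abs_le]
    constructor
    · rw [Int.le_floor]
      push_cast
      nlinarith
    · have : (E x i : ℝ) ≤ D := (Int.floor_le _).trans (by nlinarith)
      exact_mod_cast this
  obtain ⟨a, b, hlt, hbX, hLab, hEab⟩ := exists_lt_map_eq_of_abs_le (X := X)
    (fun x (j : Fin (N + 1 - d)) => L x j) (fun x (i : S) => E x i)
    (fun x hx j => hL x hx j (by omega)) (fun x _ i => hE x i) (by simpa using hX)
  refine ⟨b - a, fun i => z b i - z a i, by omega, by omega, by simp [z], ?_, ?_⟩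
  · intro j hj
    have : L a j = L b j := congrFun hLab ⟨j, by omega⟩
    simp only [mul_sub, Finset.sum_sub_distrib]
    exact sub_eq_zero.mpr this.symm
  · intro i hi
    have h : E b i = E a i := (congrFun hEab ⟨i, hi⟩).symm
    have h' := (Int.abs_sub_lt_one_of_floor_eq_floor h).le
    rw [← mul_sub, abs_mul, Nat.abs_cast] at h'
    rw [le_div_iff₀' hDpos]
    refine le_trans (le_of_eq ?_) h'
    congr 2
    push_cast
    ring

/-- A linear recurrence propagates bounds on the first `d` terms to all terms. -/
theorem le_of_recurrence_bound {u : ℕ → ℝ} {N d : ℕ} {K E t : ℝ} (hK : 0 ≤ K) (hE : 0 ≤ E)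
    (ht : 0 ≤ t) (hinit : ∀ i < d, u i ≤ E)
    (hstep : ∀ j b, j + d ≤ N → 0 ≤ b → (∀ k < d, u (j + k) ≤ b) → u (j + d) ≤ K * b + t) :
    ∀ i ≤ N, u i ≤ (K + 1) ^ N * (E + t) := by
  have key : ∀ i ≤ N, u i ≤ (K + 1) ^ i * (E + t) := by
    intro i
    induction i using Nat.strong_induction_on with
    | _ i ih =>
      intro hi
      rcases lt_or_ge i d with hid | hid
      · calc u i ≤ 1 * (E + t) := by linarith [hinit i hid]
          _ ≤ _ := by gcongr; exact one_le_pow₀ (by linarith)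
      · obtain ⟨j, rfl⟩ := Nat.exists_eq_add_of_le' hid
        rcases Nat.eq_zero_or_pos d with rfl | hd
        · have := hstep j 0 hi le_rfl (by simp)
          calc _ ≤ 1 * (E + t) := by linarith
            _ ≤ _ := by gcongr; exact one_le_pow₀ (by linarith)
        · obtain ⟨m, hm⟩ : ∃ m, j + d = m + 1 := ⟨j + d - 1, by omega⟩
          have := hstep j ((K + 1) ^ m * (E + t)) hi (by positivity) fun k hk =>
            (ih (j + k) (by omega) (by omega)).trans (by
              gcongr
              · linarith
              · omega)
          rw [hm] at this ⊢
          have h1 : t ≤ (K + 1) ^ m * (E + t) := by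
            calc t ≤ 1 * (E + t) := by linarith
              _ ≤ _ := by gcongr; exact one_le_pow₀ (by linarith)
          rw [pow_succ]
          linarith
  intro i hi
  refine (key i hi).trans ?_
  gcongr
  linarith

/-- Approximations of quality `H ^ (-t)` at size `H ^ s`, for arbitrarily large `H`, bound `λ_N`
from below by `t / s`. -/
theorem le_lambdaExp_of_forall_exists {N : ℕ} {ζ s t l C : ℝ} (hC : 0 < C) (hs : 0 < s)
    (hl : l * s < t)
    (h : ∀ H₀ : ℕ, ∃ H : ℝ, H₀ ≤ H ∧ ∃ (x : ℤ) (y : ℕ → ℤ), 1 ≤ x ∧ (x : ℝ) ≤ C * H ^ s ∧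
      ∀ i ≤ N, |ζ ^ i * x - y i| ≤ C * H ^ (-t)) :
    (l : EReal) ≤ lambdaExp N ζ := by
  refine le_sSup (Set.mem_image_of_mem _ fun X₀ => ?_)
  have h1 : ∀ᶠ H : ℝ in atTop, X₀ ≤ C * H ^ s :=
    ((tendsto_rpow_atTop hs).const_mul_atTop hC).eventually_ge_atTop X₀
  have h2 : ∀ᶠ H : ℝ in atTop, C * C ^ l ≤ H ^ (t - l * s) :=
    (tendsto_rpow_atTop (by linarith)).eventually_ge_atTop _
  obtain ⟨H₁, hH₁⟩ := eventually_atTop.mp ((h1.and h2).and (eventually_gt_atTop 0))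
  obtain ⟨H₀, hH₀⟩ := exists_nat_ge H₁
  obtain ⟨H, hH, x, y, hx, hxX, hy⟩ := h H₀
  obtain ⟨⟨ha, hb⟩, hpos⟩ := hH₁ H (hH₀.trans hH)
  refine ⟨C * H ^ s, ha, x, fun i => y (i + 1), hx.trans (le_abs_self x), ?_, fun i => ?_⟩
  · rw [← Int.cast_abs, abs_of_nonneg (by omega)]
    exact hxX
  · refine (hy _ i.2).trans ?_
    rw [Real.mul_rpow hC.le (Real.rpow_nonneg hpos.le _), ← Real.rpow_mul hpos.le,
      Real.rpow_neg hC.le, inv_mul_eq_div, le_div_iff₀ (Real.rpow_pos_of_pos hC _),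
      mul_right_comm]
    calc C * C ^ l * H ^ (-t) ≤ H ^ (t - l * s) * H ^ (-t) := by gcongr
      _ = H ^ (s * -l) := by
        rw [← Real.rpow_add hpos]
        congr 1
        ring

/-- Solving a relation `p r + ∑ c_k e_k = v` for the term `p r`. -/
theorem abs_mul_add_sum_le {n : ℕ} {H ε t p r v : ℝ} {c e : ℕ → ℝ} (hH : 0 ≤ H)
    (hc : ∀ k, |c k| ≤ H) (he : ∀ k < n, |e k| ≤ ε) (hv : |v| ≤ t)
    (h : p * r + ∑ k ∈ Finset.range n, c k * e k = v) :
    |p| * |r| ≤ n * (H * ε) + t := by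
  have h1 := abs_sum_mul_le hH hc he
  rw [← abs_mul, eq_sub_of_add_eq h]
  exact (abs_sub _ _).trans (by linarith)

/-- If `w_m(ζ) = ∞`, then `λ_N(ζ) ≥ 1 / (m - 1)`: the recurrence coming from a polynomial of
degree `d ≤ m` with a tiny value leaves only `d - 1` coordinates to be approximated. The growth of
the errors along the recurrence is only a fixed power of the height, and is absorbed by taking the
approximation scale `H ^ a` with `a` large. -/
theorem le_lambdaExp_of_wExp_eq_top {ζ l : ℝ} {m N : ℕ} (hm : 1 ≤ m) (hN : m ≤ N)
    (hw : wExp m ζ = ⊤) (hl : l * ((m : ℝ) - 1) < 1) : (l : EReal) ≤ lambdaExp N ζ := by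
  obtain ⟨m, rfl⟩ := Nat.exists_eq_add_of_le' hm
  have hr : 0 < 1 - l * m := by push_cast at hl; linarith
  -- as `a → ∞`, the exponent `(a - N) / (a m + N)` of the construction tends to `1 / m > l`
  obtain ⟨a, ha⟩ := exists_nat_gt (max 1 ((N + l * N) / (1 - l * m)))
  have ha1 : 1 ≤ a := by exact_mod_cast ((le_max_left _ _).trans_lt ha).le
  have ha2 : l * (a * m + N) < a - N := by
    have := (div_lt_iff₀ hr).mp ((le_max_right _ _).trans_lt ha)
    linarith
  set A : ℝ := max 1 |ζ| with hAdef
  have hA : 1 ≤ A := le_max_left _ _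
  set C₁ : ℕ := (2 * m + 7) ^ N * 3 ^ m with hC₁
  set C : ℝ := ((m + 1 : ℕ) + 1) ^ N * (1 + C₁ * A ^ N) with hC
  have hAN : 1 ≤ A ^ N := one_le_pow₀ hA
  have hCC : (C₁ : ℝ) ≤ C := by
    have h1 : (1 : ℝ) ≤ ((m + 1 : ℕ) + 1) ^ N := one_le_pow₀ (by push_cast; linarith)
    have h2 : (C₁ : ℝ) ≤ C₁ * A ^ N := le_mul_of_one_le_right (Nat.cast_nonneg _) hAN
    rw [hC]
    nlinarith
  have hCpos : 0 < C := lt_of_lt_of_le (by rw [hC₁]; positivity) hCC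
  refine le_lambdaExp_of_forall_exists (s := a * m + N) (t := a - N) hCpos ?_ ha2 fun H₀ => ?_
  · have : (1 : ℝ) ≤ N := by exact_mod_cast hm.trans hN
    positivity
  obtain ⟨B, hB⟩ := exists_nat_ge (C₁ * A ^ N)
  obtain ⟨P, hPdeg, hPH, hP1, hPval⟩ := exists_abs_aeval_le_of_lt_wExp
    (w := ((a * m + N + a : ℕ) : ℝ)) (by rw [hw]; exact EReal.coe_lt_top _) (max H₀ (max B 2))
  set H := polyHeight P with hH
  have hH1 : (1 : ℝ) ≤ H := by exact_mod_cast hP1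
  have hHpos : (0 : ℝ) < H := by linarith
  have hH2 : 2 ≤ H := by omega
  have hBH : (C₁ * A ^ N : ℝ) ≤ H := hB.trans (by exact_mod_cast (by omega : B ≤ H))
  rw [Real.rpow_neg hHpos.le, Real.rpow_natCast] at hPval
  -- a constant polynomial has no value in `(0, 1)`
  have hd : 1 ≤ P.natDegree := by
    by_contra hcon
    obtain ⟨c, hc⟩ := Polynomial.natDegree_eq_zero.mp (by omega : P.natDegree = 0)
    have hc0 : c ≠ 0 := by
      rintro rfl
      simp [← hc, polyHeight] at hH
      omega
    have hc1 : (1 : ℝ) ≤ |(c : ℝ)| := by exact_mod_cast Int.one_le_abs hc0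
    have hval : |Polynomial.aeval ζ P| = |(c : ℝ)| := by simp [← hc]
    have hlt : ((H : ℝ) ^ (a * m + N + a))⁻¹ < 1 :=
      inv_lt_one_of_one_lt₀ (one_lt_pow₀ (by exact_mod_cast hH2) (by omega))
    linarith
  set d := P.natDegree with hddef
  have hcard : (Finset.Icc 1 (d - 1)).card = d - 1 := by simp
  have hXbound : (2 * ((d + 1) * H + 1) + 1) ^ (N + 1 - d) *
      (2 * H ^ a + 1) ^ (Finset.Icc 1 (d - 1)).card ≤ C₁ * H ^ (a * m + N) := by
    rw [hcard]
    have h1 : 2 * ((d + 1) * H + 1) + 1 ≤ (2 * m + 7) * H := by nlinarith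
    have h2 : 2 * H ^ a + 1 ≤ 3 * H ^ a := by
      have := Nat.one_le_pow a H (by omega)
      omega
    calc _ ≤ ((2 * m + 7) * H) ^ (N + 1 - d) * (3 * H ^ a) ^ (d - 1) := by gcongr
      _ ≤ ((2 * m + 7) * H) ^ N * (3 * H ^ a) ^ m := by
        gcongr
        · exact Nat.one_le_iff_ne_zero.mpr (by positivity)
        · omega
        · exact Nat.one_le_iff_ne_zero.mpr (by positivity)
        · omega
      _ = C₁ * H ^ (a * m + N) := by rw [hC₁, mul_pow, mul_pow]; ring
  have htval : ((C₁ * H ^ (a * m + N) : ℕ) : ℝ) * A ^ N * |Polynomial.aeval ζ P| ≤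
      C₁ * A ^ N / H ^ a := by
    calc _ ≤ ((C₁ * H ^ (a * m + N) : ℕ) : ℝ) * A ^ N * ((H : ℝ) ^ (a * m + N + a))⁻¹ := by
          gcongr
      _ = _ := by
        push_cast
        rw [pow_add (H : ℝ) (a * m + N) a]
        field_simp
  have hHa : (H : ℝ) ≤ H ^ a := le_self_pow₀ hH1 (by omega)
  obtain ⟨x, y, hx1, hxX, hy0, hrec, hS⟩ := exists_recurrence_approx (Finset.Icc 1 (d - 1)) hA
    (le_max_right 1 |ζ|) le_rfl le_rfl (Nat.one_le_pow a H (by omega)) hXbound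
    (htval.trans (div_le_one_of_le₀ (hBH.trans hHa) (by positivity)))
  have hbound := le_of_recurrence_bound (u := fun i => |ζ ^ i * (x : ℝ) - y i|) (N := N) (d := d)
    (K := d * H) (E := 1 / H ^ a) (t := C₁ * A ^ N / H ^ a)
    (by positivity) (by positivity) (by positivity) ?_ ?_
  · refine ⟨H, by exact_mod_cast (by omega : H₀ ≤ H), x, y, hx1, ?_, fun i hi => ?_⟩
    · calc (x : ℝ) ≤ ((C₁ * H ^ (a * m + N) : ℕ) : ℝ) := by exact_mod_cast hxX
        _ = C₁ * (H : ℝ) ^ ((a : ℝ) * m + N) := by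
          rw [show ((a : ℝ) * m + N) = ((a * m + N : ℕ) : ℝ) by push_cast; ring,
            Real.rpow_natCast]
          push_cast
          ring
        _ ≤ _ := by gcongr
    · refine (hbound i hi).trans ?_
      have hd' : (d : ℝ) ≤ (m + 1 : ℕ) := by exact_mod_cast hPdeg
      calc ((d : ℝ) * H + 1) ^ N * (1 / H ^ a + C₁ * A ^ N / H ^ a)
          ≤ (((m + 1 : ℕ) + 1) * H) ^ N * (1 / H ^ a + C₁ * A ^ N / H ^ a) := by
            gcongr
            nlinarith
        _ = C * (H : ℝ) ^ (-((a : ℝ) - N)) := by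
          rw [neg_sub, Real.rpow_sub hHpos, Real.rpow_natCast, Real.rpow_natCast, hC, mul_pow]
          ring
  · intro i hi
    rcases Nat.eq_zero_or_pos i with rfl | hi0
    · simp only [pow_zero, one_mul, hy0, sub_self, abs_zero]
      positivity
    · exact_mod_cast hS i (Finset.mem_Icc.mpr ⟨hi0, by omega⟩)
  · intro j b hj hb hprev
    have hsum := sum_coeff_mul_eq (θ := ζ) (P := P) le_rfl x y j
    rw [hrec j hj, Int.cast_zero, eq_comm, sub_eq_zero, Finset.sum_range_succ, add_comm (Finset.sum _ _)] at hsum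
    have := abs_mul_add_sum_le (Nat.cast_nonneg H)
      (fun k => abs_coeff_le_polyHeight P k) hprev
      ((abs_mul_pow_mul_aeval_le hA (le_max_right 1 |ζ|) (by omega : j ≤ N) (by omega)
        hxX).trans htval) hsum.symm
    have hlead : (1 : ℝ) ≤ |(P.coeff P.natDegree : ℝ)| := by
      have : P.leadingCoeff ≠ 0 := by
        rw [Polynomial.leadingCoeff_ne_zero]
        rintro rfl
        simp [hddef] at hd
      exact_mod_cast Int.one_le_abs this
    calc _ ≤ |(P.coeff P.natDegree : ℝ)| * |ζ ^ (j + d) * (x : ℝ) - y (j + d)| :=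
          le_mul_of_one_le_left (abs_nonneg _) hlead
      _ ≤ _ := this
      _ = _ := by ring

/-- Approximations to the powers of `θ` yield approximations to the powers of `θ + c`. -/
theorem exists_approx_add_nat {θ ε : ℝ} {N c : ℕ} {x : ℤ} {y : ℕ → ℤ} (hε : 0 ≤ ε)
    (h : ∀ i ≤ N, |θ ^ i * x - y i| ≤ ε) :
    ∃ y' : ℕ → ℤ, ∀ i ≤ N, |(θ + c) ^ i * x - y' i| ≤ (1 + c) ^ N * ε := by
  refine ⟨fun i => ∑ k ∈ Finset.range (i + 1), y k * c ^ (i - k) * i.choose k, fun i hi => ?_⟩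
  have hsum : (θ + c) ^ i * (x : ℝ) -
      ((∑ k ∈ Finset.range (i + 1), y k * c ^ (i - k) * i.choose k : ℤ) : ℝ) =
      ∑ k ∈ Finset.range (i + 1), (c : ℝ) ^ (i - k) * i.choose k * (θ ^ k * x - y k) := by
    rw [add_pow, Finset.sum_mul]
    push_cast
    rw [← Finset.sum_sub_distrib]
    exact Finset.sum_congr rfl fun k _ => by ring
  rw [hsum]
  calc _ ≤ ∑ k ∈ Finset.range (i + 1), (c : ℝ) ^ (i - k) * i.choose k * ε := by
        refine (Finset.abs_sum_le_sum_abs _ _).trans (Finset.sum_le_sum fun k hk => ?_)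
        rw [abs_mul, abs_of_nonneg (by positivity : (0 : ℝ) ≤ (c : ℝ) ^ (i - k) * i.choose k)]
        have := Finset.mem_range_succ_iff.mp hk
        gcongr
        exact h k (by omega)
    _ = (1 + c) ^ i * ε := by
        rw [add_pow, Finset.sum_mul]
        exact Finset.sum_congr rfl fun k _ => by ring
    _ ≤ _ := by
        gcongr
        linarith [Nat.cast_nonneg (α := ℝ) c]

/-- If `w_n(ζ) / n` is large, then so is `N λ_N(ζ)` for a suitable `N ≥ n`. After a translation
the constant coefficient of the small polynomial is comparable with its height, so that the
recurrence, run downwards, only enlarges the errors by a constant factor. -/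
theorem le_lambdaExp_of_lt_wExp {ζ : ℝ} {n a : ℕ} (hn : 1 ≤ n) (ha : 1 ≤ a)
    (hw : ((((3 * a + 1) * n : ℕ) : ℝ) : EReal) < wExp n ζ) :
    ((1 / (4 * n : ℝ) : ℝ) : EReal) ≤ lambdaExp ((a + 1) * n) ζ := by
  set N := (a + 1) * n with hN
  have hNn : N = a * n + n := by rw [hN]; ring
  have han : a ≤ a * n := Nat.le_mul_of_pos_right a hn
  obtain ⟨c₀, hc₀, hlarge⟩ := exists_polyHeight_le_abs_eval n
  obtain ⟨C₁, hC₁, htaylor⟩ := exists_polyHeight_taylor_le n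
  set A : ℝ := 1 + |ζ| + n with hAdef
  have hA : 1 ≤ A := by have := abs_nonneg ζ; rw [hAdef]; linarith [Nat.cast_nonneg (α := ℝ) n]
  have hAN : 1 ≤ A ^ N := one_le_pow₀ hA
  set C₂ : ℕ := ((2 * n + 5) * C₁) ^ (a * n + 1) * 3 ^ n with hC₂
  set K : ℝ := n * C₁ / c₀ with hK
  have hK0 : 0 ≤ K := by positivity
  set C : ℝ := (1 + n) ^ N * ((K + 1) ^ N * (1 + C₂ * A ^ N)) with hC
  have hC₂1 : 1 ≤ C₂ := Nat.one_le_iff_ne_zero.mpr (by positivity)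
  have hCC : (C₂ : ℝ) ≤ C := by
    have h1 : (1 : ℝ) ≤ (1 + n) ^ N := one_le_pow₀ (by linarith [Nat.cast_nonneg (α := ℝ) n])
    have h2 : (1 : ℝ) ≤ (K + 1) ^ N := one_le_pow₀ (by linarith)
    have h3 : (C₂ : ℝ) ≤ C₂ * A ^ N := le_mul_of_one_le_right (Nat.cast_nonneg _) hAN
    calc (C₂ : ℝ) ≤ 1 * (1 * (1 + C₂ * A ^ N)) := by linarith
      _ ≤ C := by rw [hC]; gcongr
  have hCpos : 0 < C := lt_of_lt_of_le (by exact_mod_cast hC₂1) hCC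
  have hn' : (1 : ℝ) ≤ n := by exact_mod_cast hn
  have ha' : (1 : ℝ) ≤ a := by exact_mod_cast ha
  refine le_lambdaExp_of_forall_exists (s := ((2 * (a * n) + 1 : ℕ) : ℝ)) (t := (a : ℕ)) hCpos
    (by positivity) ?_ fun H₀ => ?_
  · push_cast
    rw [div_mul_eq_mul_div, div_lt_iff₀ (by positivity)]
    nlinarith
  obtain ⟨B, hB⟩ := exists_nat_ge (C₂ * A ^ N)
  obtain ⟨P, hPdeg, hPH, hP1, hPval⟩ := exists_abs_aeval_le_of_lt_wExp hw (max H₀ B)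
  set H := polyHeight P with hH
  have hH1 : (1 : ℝ) ≤ H := by exact_mod_cast hP1
  have hHpos : (0 : ℝ) < H := by linarith
  have hBH : (C₂ * A ^ N : ℝ) ≤ H := hB.trans (by exact_mod_cast (by omega : B ≤ H))
  rw [Real.rpow_neg hHpos.le, Real.rpow_natCast] at hPval
  obtain ⟨c, hcn, hc⟩ := hlarge P hPdeg
  -- `Q(T) = P(T + c)`, to be used at the point `ζ - c`
  set Q := P.taylor (c : ℤ) with hQ
  have hQdeg : Q.natDegree ≤ n := by rw [hQ, Polynomial.natDegree_taylor]; exact hPdeg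
  have hQH : polyHeight Q ≤ C₁ * H := htaylor P hPdeg c hcn
  have hQ0 : Q.coeff 0 = P.eval (c : ℤ) := Polynomial.taylor_coeff_zero _ _
  have hθ : |ζ - c| ≤ A := by
    have h1 : (c : ℝ) ≤ n := by exact_mod_cast hcn
    refine (abs_sub _ _).trans ?_
    rw [Nat.abs_cast, hAdef]
    linarith
  have hQval : Polynomial.aeval (ζ - c) Q = Polynomial.aeval ζ P := by
    rw [hQ, Polynomial.taylor_apply, Polynomial.aeval_comp]
    simp
  have hXbound : (2 * ((n + 1) * (C₁ * H) + 1) + 1) ^ (N + 1 - n) *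
      (2 * H ^ a + 1) ^ (Finset.Icc (N + 1 - n) N).card ≤ C₂ * H ^ (2 * (a * n) + 1) := by
    have hcard : (Finset.Icc (N + 1 - n) N).card = n := by
      rw [Nat.card_Icc]
      omega
    have hCH : 1 ≤ C₁ * H := Nat.mul_pos hC₁ hP1
    have h1 : 2 * ((n + 1) * (C₁ * H) + 1) + 1 ≤ (2 * n + 5) * C₁ * H := by nlinarith
    have h2 : 2 * H ^ a + 1 ≤ 3 * H ^ a := by
      have := Nat.one_le_pow a H (by omega)
      omega
    rw [hcard, show N + 1 - n = a * n + 1 by omega]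
    calc _ ≤ ((2 * n + 5) * C₁ * H) ^ (a * n + 1) * (3 * H ^ a) ^ n := by gcongr
      _ = C₂ * H ^ (2 * (a * n) + 1) := by rw [hC₂, mul_pow (_ * C₁) H, mul_pow 3]; ring
  have htval : ((C₂ * H ^ (2 * (a * n) + 1) : ℕ) : ℝ) * A ^ N *
      |Polynomial.aeval (ζ - c) Q| ≤ C₂ * A ^ N / H ^ a := by
    have hexp : 2 * (a * n) + 1 + a ≤ (3 * a + 1) * n := by nlinarith
    calc _ ≤ ((C₂ * H ^ (2 * (a * n) + 1) : ℕ) : ℝ) * A ^ N *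
          ((H : ℝ) ^ (2 * (a * n) + 1 + a))⁻¹ := by
          rw [hQval]
          gcongr
          refine hPval.trans ?_
          gcongr
      _ = _ := by
        push_cast
        rw [pow_add (H : ℝ) (2 * (a * n) + 1) a]
        field_simp
  have hHa : (H : ℝ) ≤ H ^ a := le_self_pow₀ hH1 (by omega)
  obtain ⟨x, y, hx1, hxX, -, hrec, hS⟩ := exists_recurrence_approx (Finset.Icc (N + 1 - n) N) hA
    hθ hQdeg hQH (Nat.one_le_pow a H (by omega)) hXbound
    (htval.trans (div_le_one_of_le₀ (hBH.trans hHa) (by positivity)))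
  -- reversing the indices turns the downward recurrence into an upward one
  have hbound := le_of_recurrence_bound
    (u := fun i => |(ζ - c) ^ (N - i) * (x : ℝ) - y (N - i)|) (N := N) (d := n)
    (K := K) (E := 1 / H ^ a) (t := C₂ * A ^ N / H ^ a)
    hK0 (by positivity) (by positivity) ?_ ?_
  · obtain ⟨y', hy'⟩ := exists_approx_add_nat (c := c) (N := N) (x := x) (y := y)
      (ε := (K + 1) ^ N * (1 / H ^ a + C₂ * A ^ N / H ^ a)) (by positivity) fun i hi => by
        have := hbound (N - i) (by omega)
        simpa only [Nat.sub_sub_self hi] using this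
    refine ⟨H, by exact_mod_cast (by omega : H₀ ≤ H), x, y', hx1, ?_, fun i hi => ?_⟩
    · rw [Real.rpow_natCast]
      calc (x : ℝ) ≤ ((C₂ * H ^ (2 * (a * n) + 1) : ℕ) : ℝ) := by exact_mod_cast hxX
        _ = C₂ * (H : ℝ) ^ (2 * (a * n) + 1) := by push_cast; ring
        _ ≤ _ := by gcongr
    · have := hy' i hi
      rw [sub_add_cancel] at this
      refine this.trans ?_
      calc _ ≤ (1 + n : ℝ) ^ N * ((K + 1) ^ N * (1 / H ^ a + C₂ * A ^ N / H ^ a)) := by gcongr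
        _ = C * (H : ℝ) ^ (-((a : ℕ) : ℝ)) := by
          rw [Real.rpow_neg hHpos.le, Real.rpow_natCast, hC]
          ring
  · intro i hi
    exact_mod_cast hS (N - i) (Finset.mem_Icc.mpr ⟨by omega, by omega⟩)
  · intro j b hj hb hprev
    have hsum := sum_coeff_mul_eq (θ := ζ - c) hQdeg x y (N - (j + n))
    rw [hrec _ (by omega), Int.cast_zero, eq_comm, sub_eq_zero, Finset.sum_range_succ',
      add_comm (Finset.sum _ _), add_zero] at hsum
    have hQ0' : c₀ * H ≤ |(Q.coeff 0 : ℝ)| := by rw [hQ0]; exact hc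
    have hQpos : 0 < |(Q.coeff 0 : ℝ)| := lt_of_lt_of_le (by positivity) hQ0'
    have hQ1 : (1 : ℝ) ≤ |(Q.coeff 0 : ℝ)| := by
      have : Q.coeff 0 ≠ 0 := by
        intro h0
        simp [h0] at hQpos
      exact_mod_cast Int.one_le_abs this
    have := abs_mul_add_sum_le (n := n) (H := C₁ * H) (ε := b) (by positivity)
      (fun k => (abs_coeff_le_polyHeight Q (k + 1)).trans (by exact_mod_cast hQH))
      (fun k hk => by
        have := hprev (n - (k + 1)) (by omega)
        rwa [show N - (j + (n - (k + 1))) = N - (j + n) + (k + 1) by omega] at this)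
      ((abs_mul_pow_mul_aeval_le hA hθ (by omega : N - (j + n) ≤ N) (by omega)
        hxX).trans htval) hsum.symm
    rw [← le_div_iff₀' hQpos, add_div] at this
    refine this.trans (add_le_add ?_ (div_le_self (by positivity) hQ1))
    calc n * (C₁ * H * b) / |(Q.coeff 0 : ℝ)| ≤ n * (C₁ * H * b) / (c₀ * H) := by gcongr
      _ = K * b := by rw [hK]; field_simp

/-! ### Annihilators of truncated moment functionals -/

/-- A linear functional on `K[X]` that kills the multiples of `P` up to degree `N` agrees, up to
degree `N`, with one that kills all multiples of `P`: precompose with reduction modulo `P`. -/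
theorem exists_extension_killing_multiples {K : Type*} [Field K]
    (Λ : Polynomial K →ₗ[K] K) {P : Polynomial K} (hP : P ≠ 0) {N : ℕ} (hN : P.natDegree ≤ N)
    (h : ∀ Q : Polynomial K, Q.natDegree + P.natDegree ≤ N → Λ (P * Q) = 0) :
    ∃ Λ' : Polynomial K →ₗ[K] K, (∀ R : Polynomial K, R.natDegree ≤ N → Λ' R = Λ R) ∧
      ∀ Q : Polynomial K, Λ' (P * Q) = 0 := by
  set M := P * Polynomial.C P.leadingCoeff⁻¹ with hM
  have hmonic : M.Monic := Polynomial.monic_mul_leadingCoeff_inv hP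
  have hdeg : M.natDegree = P.natDegree := Polynomial.natDegree_mul_leadingCoeff_inv P hP
  refine ⟨Λ ∘ₗ Polynomial.modByMonicHom M, fun R hR => ?_, fun Q => ?_⟩
  · have hsplit := Polynomial.modByMonic_add_div R M
    have h0 : Λ (M * (R /ₘ M)) = 0 := by
      rw [hM, mul_assoc, ← hM]
      refine h _ ?_
      have h1 := Polynomial.natDegree_C_mul_le P.leadingCoeff⁻¹ (R /ₘ M)
      rw [Polynomial.natDegree_divByMonic R hmonic, hdeg] at h1
      omega
    conv_rhs => rw [← hsplit, map_add, h0, add_zero]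
    rfl
  · have hdvd : M ∣ P * Q := by
      refine Dvd.dvd.mul_right ?_ Q
      exact ⟨Polynomial.C P.leadingCoeff, by
        rw [hM, mul_assoc, ← Polynomial.C_mul,
          inv_mul_cancel₀ (Polynomial.leadingCoeff_ne_zero.mpr hP), Polynomial.C_1, mul_one]⟩
    have : (P * Q) %ₘ M = 0 := (Polynomial.modByMonic_eq_zero_iff_dvd hmonic).mpr hdvd
    simp [Polynomial.modByMonicHom, this]

theorem exists_isPrimitive_associated {g : Polynomial ℚ} (hg : g ≠ 0) :
    ∃ G : Polynomial ℤ, G.IsPrimitive ∧ Associated (G.map (Int.castRingHom ℚ)) g := by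
  obtain ⟨b, hbmem, hb⟩ := IsLocalization.integerNormalization_spec (nonZeroDivisors ℤ) g
  set h := IsLocalization.integerNormalization (nonZeroDivisors ℤ) g with hh
  have hb0 : b ≠ 0 := nonZeroDivisors.ne_zero hbmem
  have hbg : h.map (Int.castRingHom ℚ) = Polynomial.C (b : ℚ) * g := by
    rw [← Polynomial.smul_eq_C_mul, Int.cast_smul_eq_zsmul]
    exact hb
  have hne : h ≠ 0 := by
    intro h0
    rw [h0, Polynomial.map_zero, eq_comm, mul_eq_zero] at hbg
    rcases hbg with h1 | h1
    · simp [hb0] at h1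
    · exact hg h1
  refine ⟨h.primPart, h.isPrimitive_primPart, ?_⟩
  have hc : h.content ≠ 0 := by rwa [Ne, Polynomial.content_eq_zero_iff]
  have hC : ∀ {c : ℤ}, c ≠ 0 → IsUnit (Polynomial.C (c : ℚ)) := fun hc =>
    Polynomial.isUnit_C.mpr (isUnit_iff_ne_zero.mpr (by exact_mod_cast hc))
  have h1 : Polynomial.C (h.content : ℚ) * h.primPart.map (Int.castRingHom ℚ) =
      Polynomial.C (b : ℚ) * g := by
    rw [← hbg]
    conv_rhs => rw [h.eq_C_content_mul_primPart]
    simp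
  exact (associated_isUnit_mul_right_iff (hC hb0)).mp
    (h1 ▸ ((associated_isUnit_mul_left_iff (hC hc)).mpr (Associated.refl _)).symm)

/-- If a functional on `ℚ[X]` kills the shifts of an integer polynomial `P`, up to degree `N`,
then all integer polynomials of degree at most `n` whose shifts it kills up to degree `N` are
divisible by a single `G`: the primitive generator of the ideal of polynomials annihilated by
an extension of the functional. -/
theorem exists_dvd_of_forall_shift_eq_zero (Λ : Polynomial ℚ →ₗ[ℚ] ℚ) {P : Polynomial ℤ}
    (hP : P ≠ 0) {n N : ℕ} (hN : n + P.natDegree ≤ N)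
    (h : ∀ j, j + P.natDegree ≤ N →
      Λ (Polynomial.X ^ j * P.map (Int.castRingHom ℚ)) = 0) :
    ∃ G : Polynomial ℤ, G ≠ 0 ∧ G.natDegree ≤ P.natDegree ∧
      Λ (G.map (Int.castRingHom ℚ)) = 0 ∧
      ∀ R : Polynomial ℤ, R.natDegree ≤ n →
        (∀ j, j + n ≤ N → Λ (Polynomial.X ^ j * R.map (Int.castRingHom ℚ)) = 0) → G ∣ R := by
  set P' := P.map (Int.castRingHom ℚ) with hP'
  have hdeg : ∀ R : Polynomial ℤ, (R.map (Int.castRingHom ℚ)).natDegree = R.natDegree :=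
    fun R => Polynomial.natDegree_map_eq_of_injective (RingHom.injective_int _) R
  have hP'0 : P' ≠ 0 := (Polynomial.map_ne_zero_iff (RingHom.injective_int _)).mpr hP
  -- expand a product in powers of `X`
  have hexpand : ∀ (Ψ : Polynomial ℚ →ₗ[ℚ] ℚ) (S R : Polynomial ℚ),
      (∀ j ≤ S.natDegree, Ψ (Polynomial.X ^ j * R) = 0) → Ψ (R * S) = 0 := by
    intro Ψ S R hS
    rw [S.as_sum_range_C_mul_X_pow, Finset.mul_sum, map_sum]
    refine Finset.sum_eq_zero fun j hj => ?_
    rw [show R * (Polynomial.C (S.coeff j) * Polynomial.X ^ j) =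
      S.coeff j • (Polynomial.X ^ j * R) by rw [Polynomial.smul_eq_C_mul]; ring, map_smul,
      hS j (Finset.mem_range_succ_iff.mp hj), smul_zero]
  obtain ⟨Λ', hagree, hkill⟩ := exists_extension_killing_multiples Λ hP'0 (N := N)
    (by rw [hdeg]; omega) fun Q hQ => hexpand Λ Q P' fun j hj => h j (by rw [hdeg] at hQ; omega)
  let I : Ideal (Polynomial ℚ) :=
    { carrier := {R | ∀ Q, Λ' (R * Q) = 0}
      zero_mem' := by simp
      add_mem' := by
        intro a b ha hb Q
        rw [add_mul, map_add, ha, hb, add_zero]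
      smul_mem' := by
        intro c R hR Q
        rw [smul_eq_mul, mul_comm c, mul_assoc]
        exact hR _ }
  obtain ⟨g, hg⟩ := (IsPrincipalIdealRing.principal I).principal
  have hmem : ∀ R, g ∣ R ↔ ∀ Q, Λ' (R * Q) = 0 := by
    intro R
    rw [← Ideal.mem_span_singleton, ← Ideal.submodule_span_eq, ← hg]
    rfl
  have hgP : g ∣ P' := (hmem P').mpr hkill
  have hg0 : g ≠ 0 := ne_zero_of_dvd_ne_zero hP'0 hgP
  obtain ⟨G, hGprim, hGg⟩ := exists_isPrimitive_associated hg0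
  have hdvd : ∀ R : Polynomial ℤ, g ∣ R.map (Int.castRingHom ℚ) → G ∣ R := fun R hR =>
    (Polynomial.IsPrimitive.Int.dvd_iff_map_cast_dvd_map_cast G R hGprim).mpr
      (hGg.dvd.trans hR)
  have hGP : G.natDegree ≤ P.natDegree := Polynomial.natDegree_le_of_dvd (hdvd P hgP) hP
  refine ⟨G, hGprim.ne_zero, hGP, ?_, fun R hR hRj => hdvd R ((hmem _).mpr fun Q => ?_)⟩
  · rw [← hagree _ (by rw [hdeg]; omega)]
    simpa using (hmem _).mp hGg.symm.dvd 1
  · rw [← EuclideanDomain.div_add_mod Q P', mul_add, map_add,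
      show R.map (Int.castRingHom ℚ) * (P' * (Q / P')) =
        P' * (R.map (Int.castRingHom ℚ) * (Q / P')) by ring, hkill, zero_add]
    refine hexpand Λ' _ _ fun j hj => ?_
    have hmod : (Q % P').natDegree ≤ P.natDegree := by
      rw [← hdeg P]
      exact Polynomial.natDegree_le_natDegree (EuclideanDomain.mod_lt Q hP'0).le
    rw [hagree, hRj j (by omega)]
    refine Polynomial.natDegree_mul_le.trans ?_
    rw [Polynomial.natDegree_X_pow, hdeg]
    omega

/-- The functional on `ℚ[X]` sending `X ^ i` to `y i`. -/
noncomputable def momentFunctional (y : ℕ → ℤ) : Polynomial ℚ →ₗ[ℚ] ℚ :=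
  Polynomial.lsum fun i => (y i : ℚ) • LinearMap.id

theorem momentFunctional_X_pow_mul_map (y : ℕ → ℤ) {d : ℕ} {R : Polynomial ℤ}
    (hR : R.natDegree ≤ d) (j : ℕ) :
    momentFunctional y (Polynomial.X ^ j * R.map (Int.castRingHom ℚ)) =
      ((∑ k ∈ Finset.range (d + 1), R.coeff k * y (j + k) : ℤ) : ℚ) := by
  conv_lhs => rw [R.as_sum_range' (d + 1) (Nat.lt_succ_of_le hR)]
  rw [Polynomial.map_sum, Finset.mul_sum, map_sum]
  push_cast
  refine Finset.sum_congr rfl fun k _ => ?_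
  rw [Polynomial.map_monomial, Polynomial.X_pow_mul_monomial, momentFunctional,
    Polynomial.lsum_apply, Polynomial.sum_monomial_index _ _ (by simp)]
  simp [add_comm, mul_comm]

/-! ### Upper bounds for `λ_n` -/

/-- Pigeonhole: many integer polynomials of bounded degree and height on which the functional
`T ^ k ↦ y k` vanishes. -/
theorem exists_finset_sum_coeff_mul_eq_zero {n B Y K : ℕ} {y : ℕ → ℤ}
    (hy : ∀ k ≤ n, |y k| ≤ Y) (hK : (2 * ((n + 1) * (B * Y)) + 1) * K < (B + 1) ^ (n + 1)) :
    ∃ F : Finset (Polynomial ℤ), K < F.card ∧ ∀ R ∈ F, R.natDegree ≤ n ∧ polyHeight R ≤ B ∧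
      ∑ k ∈ Finset.range (n + 1), R.coeff k * y k = 0 := by
  classical
  set V : ℕ := (n + 1) * (B * Y) with hV
  let s : Finset (Fin (n + 1) → ℤ) := Fintype.piFinset fun _ => Finset.Icc 0 (B : ℤ)
  let φ : (Fin (n + 1) → ℤ) → ℤ := fun f => ∑ k, f k * y k
  have hmaps : ∀ f ∈ s, φ f ∈ Finset.Icc (-(V : ℤ)) V := by
    intro f hf
    rw [Finset.mem_Icc, ← abs_le]
    refine (Finset.abs_sum_le_sum_abs _ _).trans
      ((Finset.sum_le_card_nsmul _ _ ((B : ℤ) * Y) fun k _ => ?_).trans (by simp [hV]))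
    have := Finset.mem_Icc.mp (Fintype.mem_piFinset.mp hf k)
    rw [abs_mul, abs_of_nonneg this.1]
    exact mul_le_mul this.2 (hy k (by omega)) (abs_nonneg _) (by omega)
  have hcard : (Finset.Icc (-(V : ℤ)) V).card * K < s.card := by
    have h1 : ((V : ℤ) + 1 + V).toNat = 2 * V + 1 := by omega
    have h2 : ((B : ℤ) + 1).toNat = B + 1 := by omega
    simpa [s, Fintype.card_piFinset, h1, h2] using hK
  -- differences of polynomials on which the functional takes the same value
  obtain ⟨v, -, hv⟩ := Finset.exists_lt_card_fiber_of_mul_lt_card_of_maps_to hmaps hcard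
  obtain ⟨f₀, hf₀⟩ := Finset.card_pos.mp (by omega : 0 < (s.filter fun f => φ f = v).card)
  have hinj : Function.Injective fun f : Fin (n + 1) → ℤ => Polynomial.ofFn (n + 1) (f - f₀) := by
    intro f g hfg
    funext k
    have := congrArg (fun p => Polynomial.coeff p k) hfg
    simpa only [Polynomial.ofFn_coeff_eq_val_of_lt _ k.2, Pi.sub_apply, sub_left_inj] using this
  refine ⟨(s.filter fun f => φ f = v).image fun f => Polynomial.ofFn (n + 1) (f - f₀), ?_, ?_⟩
  · rwa [Finset.card_image_of_injective _ hinj]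
  · intro R hR
    obtain ⟨f, hf, rfl⟩ := Finset.mem_image.mp hR
    rw [Finset.mem_filter] at hf hf₀
    refine ⟨Nat.lt_succ_iff.mp (Polynomial.ofFn_natDegree_lt (by omega) _),
      polyHeight_le fun i => ?_, ?_⟩
    · rcases lt_or_ge i (n + 1) with hi | hi
      · rw [Polynomial.ofFn_coeff_eq_val_of_lt _ hi, Pi.sub_apply]
        have h1 := Finset.mem_Icc.mp (Fintype.mem_piFinset.mp hf.1 ⟨i, hi⟩)
        have h2 := Finset.mem_Icc.mp (Fintype.mem_piFinset.mp hf₀.1 ⟨i, hi⟩)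
        omega
      · rw [Polynomial.ofFn_coeff_eq_zero_of_ge _ hi]
        simp
    · rw [← Fin.sum_univ_eq_sum_range
        (fun k => (Polynomial.ofFn (n + 1) (f - f₀)).coeff k * y k)]
      simp only [Polynomial.ofFn_coeff_eq_val_of_lt _ (Fin.is_lt _), Pi.sub_apply, sub_mul,
        Finset.sum_sub_distrib]
      exact sub_eq_zero.mpr (hf.2.trans hf₀.2.symm)

/-- Counting multiples of a fixed polynomial of bounded degree and height; by Gelfond's lemma the
cofactors have height at most `M`. -/
theorem card_le_of_forall_dvd {n B M : ℕ} {G : Polynomial ℤ} (hG : G.natDegree ≤ n)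
    (hM : 4 ^ n * (n + 1) * B < (M + 1) * polyHeight G) (F : Finset (Polynomial ℤ))
    (hF : ∀ R ∈ F, R.natDegree ≤ n ∧ polyHeight R ≤ B ∧ G ∣ R) :
    F.card ≤ (2 * M + 1) ^ (n + 1 - G.natDegree) := by
  classical
  have hG0 : G ≠ 0 := by
    rintro rfl
    simp [polyHeight] at hM
  have hF' : ∀ R : F, ∃ S, R.1 = G * S := fun R => (hF R.1 R.2).2.2
  choose S hS using hF'
  have hdegS : ∀ R : F, (S R).natDegree < n + 1 - G.natDegree := by
    intro R
    by_cases h0 : S R = 0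
    · rw [h0, Polynomial.natDegree_zero]
      omega
    · have h1 := (hF R.1 R.2).1
      rw [hS R, Polynomial.natDegree_mul hG0 h0] at h1
      omega
  have hheight : ∀ R : F, polyHeight (S R) ≤ M := by
    intro R
    by_cases h0 : S R = 0
    · simp [h0, polyHeight]
    · have h1 := polyHeight_mul_polyHeight_le (n := n) (mul_ne_zero hG0 h0)
        (by rw [← hS R]; exact (hF R.1 R.2).1)
      rw [← hS R] at h1
      have h2 : polyHeight G * polyHeight (S R) ≤ 4 ^ n * (n + 1) * polyHeight R.1 := by
        exact_mod_cast h1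
      have h3 : 4 ^ n * (n + 1) * polyHeight R.1 ≤ 4 ^ n * (n + 1) * B :=
        Nat.mul_le_mul_left _ (hF R.1 R.2).2.1
      have h4 : polyHeight G * polyHeight (S R) < polyHeight G * (M + 1) := by
        rw [mul_comm _ (M + 1)]
        omega
      exact Nat.lt_succ_iff.mp (lt_of_mul_lt_mul_left h4 (Nat.zero_le _))
  let T : Finset (Fin (n + 1 - G.natDegree) → ℤ) :=
    Fintype.piFinset fun _ => Finset.Icc (-(M : ℤ)) M
  have hT : T.card = (2 * M + 1) ^ (n + 1 - G.natDegree) := by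
    have h1 : ((M : ℤ) + 1 + M).toNat = 2 * M + 1 := by omega
    simp [T, Fintype.card_piFinset, h1]
  rw [← hT, ← Finset.card_attach]
  refine Finset.card_le_card_of_injOn (fun R k => (S R).coeff k) ?_ ?_
  · intro R _
    refine Finset.mem_coe.mpr (Fintype.mem_piFinset.mpr fun k => ?_)
    have := natAbs_coeff_le_polyHeight (S R) k
    have := hheight R
    rw [Finset.mem_Icc]
    change -(M : ℤ) ≤ (S R).coeff k ∧ (S R).coeff k ≤ M
    omega
  · intro R _ R' _ h
    have hSS : S R = S R' := by
      ext i
      rcases lt_or_ge i (n + 1 - G.natDegree) with hi | hi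
      · exact congrFun h ⟨i, hi⟩
      · rw [Polynomial.coeff_eq_zero_of_natDegree_lt ((hdegS R).trans_le hi),
          Polynomial.coeff_eq_zero_of_natDegree_lt ((hdegS R').trans_le hi)]
    exact Subtype.ext (by rw [hS R, hS R', hSS])

/-- An integer vector with small errors that is annihilated by a polynomial of small height is
annihilated by all its shifts: the value of a shift is an integer less than `1`. -/
theorem sum_coeff_mul_shift_eq_zero {ζ A ε : ℝ} {N d j B : ℕ} {R : Polynomial ℤ} {x : ℤ}
    {y : ℕ → ℤ} (hA : 1 ≤ A) (hζ : |ζ| ≤ A) (hε : 0 ≤ ε)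
    (hy : ∀ i ≤ N, |ζ ^ i * x - y i| ≤ ε) (hRd : R.natDegree ≤ d) (hRB : polyHeight R ≤ B)
    (hjd : j + d ≤ N) (hsmall : (N + 1) * (A ^ N + 1) * (B * ε) < 1)
    (h0 : ∑ k ∈ Finset.range (d + 1), R.coeff k * y k = 0) :
    ∑ k ∈ Finset.range (d + 1), R.coeff k * y (j + k) = 0 := by
  have herr : ∀ i, i + d ≤ N →
      |∑ k ∈ Finset.range (d + 1), (R.coeff k : ℝ) * (ζ ^ (i + k) * x - y (i + k))| ≤
        (N + 1) * (B * ε) := by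
    intro i hi
    refine (abs_sum_mul_le (n := d + 1) (Nat.cast_nonneg B)
      (fun k => (abs_coeff_le_polyHeight R k).trans (by exact_mod_cast hRB))
      (fun k hk => hy (i + k) (by omega))).trans ?_
    have : ((d + 1 : ℕ) : ℝ) ≤ N + 1 := by exact_mod_cast (by omega : d + 1 ≤ N + 1)
    gcongr
  have h1 := sum_coeff_mul_eq (θ := ζ) hRd x y 0
  simp only [zero_add, h0, Int.cast_zero, pow_zero, mul_one] at h1
  have h2 := herr 0 (by omega)
  simp only [zero_add] at h2
  rw [← sub_eq_zero.mp h1.symm] at h2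
  have h3 := sum_coeff_mul_eq (θ := ζ) hRd x y j
  have h4 : |((∑ k ∈ Finset.range (d + 1), R.coeff k * y (j + k) : ℤ) : ℝ)| < 1 := by
    rw [h3]
    refine (abs_sub _ _).trans_lt ?_
    have h5 : |ζ ^ j| ≤ A ^ N := by
      rw [abs_pow]
      exact (pow_le_pow_left₀ (abs_nonneg _) hζ j).trans (pow_le_pow_right₀ hA (by omega))
    have h6 : |(x : ℝ) * ζ ^ j * Polynomial.aeval ζ R| ≤ A ^ N * ((N + 1) * (B * ε)) := by
      rw [mul_right_comm, abs_mul, mul_comm]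
      gcongr
    have h7 := herr j hjd
    calc _ ≤ A ^ N * ((N + 1) * (B * ε)) + (N + 1) * (B * ε) := add_le_add h6 h7
      _ = (N + 1) * (A ^ N + 1) * (B * ε) := by ring
      _ < 1 := hsmall
  rw [← Int.cast_abs] at h4
  exact Int.abs_lt_one_iff.mp (by exact_mod_cast h4)

/-- The counting argument. An integer vector `(x, y_1, …, y_N)` with small errors is annihilated by
a polynomial `P` of degree at most `k`, hence by a generator `G` such that all annihilating
polynomials of degree at most `n` are multiples of `G`. If the height of `G` were large, there would
be too few of them. -/
theorem exists_annihilator_height_pow_lt {ζ A ε : ℝ} {N k n e₀ B Y : ℕ} {x : ℤ} {y : ℕ → ℤ}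
    (hA : 1 ≤ A) (hζ : |ζ| ≤ A) (hε : 0 ≤ ε) (hx : x ≠ 0) (hy0 : y 0 = x)
    (hy : ∀ i ≤ N, |ζ ^ i * x - y i| ≤ ε) (hyY : ∀ i ≤ N, |y i| ≤ Y)
    (hsmall : (N + 1) * (A ^ N + 1) * (B * ε) < 1) (hB : 1 ≤ B)
    (hk : k + e₀ ≤ n + 1) (hke : k ≤ e₀) (hN : n + k ≤ N)
    (hBk : (2 * (n + 1) + 1) * (2 * (4 ^ n * (n + 1)) + 1) ^ (n + 1) * Y ≤ B ^ k) :
    ∃ G : Polynomial ℤ, G ≠ 0 ∧ G.natDegree ≤ k ∧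
      ∑ i ∈ Finset.range (k + 1), G.coeff i * y i = 0 ∧
      (polyHeight G) ^ e₀ <
        (2 * (n + 1) + 1) * (2 * (4 ^ n * (n + 1)) + 1) ^ (n + 1) * Y := by
  have hY : 1 ≤ Y := by
    have h1 := hyY 0 (by omega)
    have h2 := Int.one_le_abs hx
    rw [hy0] at h1
    omega
  set g : ℕ := 2 * (4 ^ n * (n + 1)) + 1 with hg
  have hg1 : 1 ≤ g := by omega
  have hBY : 1 ≤ B * Y := Nat.mul_pos hB hY
  -- a polynomial of degree at most `k` annihilating the vector
  obtain ⟨P, hP0, hPk, hPB, hPy⟩ : ∃ P : Polynomial ℤ, P ≠ 0 ∧ P.natDegree ≤ k ∧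
      polyHeight P ≤ B ∧ ∑ i ∈ Finset.range (k + 1), P.coeff i * y i = 0 := by
    obtain ⟨F, hF, hFprop⟩ := exists_finset_sum_coeff_mul_eq_zero (n := k) (B := B) (K := 1)
      (y := y) (fun i hi => hyY i (by omega)) (by
        rw [mul_one]
        calc 2 * ((k + 1) * (B * Y)) + 1 ≤ (2 * (n + 1) + 1) * (B * Y) := by
              have : (k + 1) * (B * Y) ≤ (n + 1) * (B * Y) := by gcongr; omega
              nlinarith
          _ ≤ B * ((2 * (n + 1) + 1) * g ^ (n + 1) * Y) := by
              have : 1 ≤ g ^ (n + 1) := Nat.one_le_pow _ _ hg1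
              calc (2 * (n + 1) + 1) * (B * Y) = B * ((2 * (n + 1) + 1) * 1 * Y) := by ring
                _ ≤ _ := by gcongr
          _ ≤ B * B ^ k := by gcongr
          _ = B ^ (k + 1) := by ring
          _ < (B + 1) ^ (k + 1) := Nat.pow_lt_pow_left (by omega) (by omega))
    obtain ⟨P, hPF, hP0⟩ := Finset.exists_mem_ne hF 0
    exact ⟨P, hP0, hFprop P hPF⟩
  have hshift : ∀ (d : ℕ) (R : Polynomial ℤ), R.natDegree ≤ d → polyHeight R ≤ B →
      ∑ i ∈ Finset.range (d + 1), R.coeff i * y i = 0 → ∀ j, j + d ≤ N →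
      momentFunctional y (Polynomial.X ^ j * R.map (Int.castRingHom ℚ)) = 0 := by
    intro d R hRd hRB hR j hj
    rw [momentFunctional_X_pow_mul_map y hRd j,
      sum_coeff_mul_shift_eq_zero hA hζ hε hy hRd hRB hj hsmall hR, Int.cast_zero]
  have hPsum : ∑ i ∈ Finset.range (P.natDegree + 1), P.coeff i * y i = 0 := by
    rw [← hPy]
    refine Finset.sum_subset (Finset.range_subset_range.mpr (by omega)) fun i _ hi => ?_
    rw [Polynomial.coeff_eq_zero_of_natDegree_lt (by simpa using hi), zero_mul]
  obtain ⟨G, hG0, hGP, hGy, hGdvd⟩ := exists_dvd_of_forall_shift_eq_zero (momentFunctional y) hP0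
    (n := n) (N := N) (by omega)
    (hshift P.natDegree P le_rfl hPB hPsum)
  have hGsum : ∀ d, G.natDegree ≤ d → ∑ i ∈ Finset.range (d + 1), G.coeff i * y i = 0 := by
    intro d hd
    have := momentFunctional_X_pow_mul_map y hd 0
    simp only [pow_zero, one_mul, zero_add, hGy] at this
    exact_mod_cast this.symm
  have hGdeg : 1 ≤ G.natDegree := by
    by_contra hcon
    have h1 := hGsum 0 (by omega)
    have h2 : G.coeff 0 ≠ 0 := by
      have := Polynomial.leadingCoeff_ne_zero.mpr hG0
      rwa [Polynomial.leadingCoeff, (by omega : G.natDegree = 0)] at this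
    simp [hy0, hx, h2] at h1
  refine ⟨G, hG0, hGP.trans hPk, hGsum k (hGP.trans hPk), ?_⟩
  by_contra! hlarge
  set H := polyHeight G with hH
  have hH1 : 1 ≤ H := one_le_polyHeight hG0
  set e := n + 1 - G.natDegree with he
  -- working with `min H B` covers the case where the only multiple of `G` in the box is `0`
  set H₁ := min H B with hH₁
  have hH₁1 : 1 ≤ H₁ := le_min hH1 hB
  have hH₁e : (2 * (n + 1) + 1) * g ^ (n + 1) * Y ≤ H₁ ^ e := by
    rcases min_choice H B with h | h
    · rw [hH₁, h]
      exact hlarge.trans (Nat.pow_le_pow_right hH1 (by omega))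
    · rw [hH₁, h]
      exact hBk.trans (Nat.pow_le_pow_right hB (by omega))
  set M := 4 ^ n * (n + 1) * B / H with hM
  have hMlt : 4 ^ n * (n + 1) * B < (M + 1) * H := by
    rw [mul_comm (M + 1)]
    exact Nat.lt_mul_div_succ _ hH1
  have hMle : (2 * M + 1) * H₁ ≤ g * B := by
    have h1 : M * H₁ ≤ 4 ^ n * (n + 1) * B :=
      (Nat.mul_le_mul_left M (min_le_left H B)).trans (Nat.div_mul_le_self _ _)
    have h2 : H₁ ≤ B := min_le_right _ _
    rw [hg]
    nlinarith
  have hcount : (2 * ((n + 1) * (B * Y)) + 1) * (2 * M + 1) ^ e < (B + 1) ^ (n + 1) := by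
    have hpos : 0 < H₁ ^ e := Nat.pow_pos hH₁1
    refine lt_of_mul_lt_mul_right ?_ (Nat.zero_le (H₁ ^ e))
    calc (2 * ((n + 1) * (B * Y)) + 1) * (2 * M + 1) ^ e * H₁ ^ e
        = (2 * ((n + 1) * (B * Y)) + 1) * ((2 * M + 1) * H₁) ^ e := by rw [mul_pow]; ring
      _ ≤ ((2 * (n + 1) + 1) * (B * Y)) * (g * B) ^ e := by
          gcongr
          nlinarith
      _ = (2 * (n + 1) + 1) * g ^ e * Y * B ^ (e + 1) := by rw [mul_pow]; ring
      _ ≤ (2 * (n + 1) + 1) * g ^ (n + 1) * Y * B ^ (n + 1) := by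
          gcongr <;> omega
      _ ≤ H₁ ^ e * B ^ (n + 1) := by gcongr
      _ < H₁ ^ e * (B + 1) ^ (n + 1) :=
          Nat.mul_lt_mul_of_pos_left (Nat.pow_lt_pow_left (by omega) (by omega)) hpos
      _ = _ := mul_comm _ _
  obtain ⟨F, hF, hFprop⟩ := exists_finset_sum_coeff_mul_eq_zero (n := n) (B := B) (y := y)
    (fun i hi => hyY i (by omega)) hcount
  refine absurd (card_le_of_forall_dvd (by omega) hMlt F fun R hR => ?_) (not_le.mpr hF)
  obtain ⟨h1, h2, h3⟩ := hFprop R hR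
  exact ⟨h1, h2, hGdvd R h1 (hshift n R h1 h2 h3)⟩

/-- Approximations realizing the exponent `l` have unbounded `x`, and may be normalized to
`X = |x|`. -/
theorem exists_large_approx {ζ l : ℝ} {N : ℕ} (hζ : Irrational ζ) (hl : 0 < l) (hN : 1 ≤ N)
    (h : ∀ X₀ : ℝ, ∃ X : ℝ, X₀ ≤ X ∧ ∃ (x : ℤ) (y : Fin N → ℤ),
      1 ≤ |x| ∧ (|x| : ℝ) ≤ X ∧
        ∀ i : Fin N, |ζ ^ ((i : ℕ) + 1) * (x : ℝ) - (y i : ℝ)| ≤ X ^ (-l)) (X₁ : ℕ) :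
    ∃ (x : ℤ) (y : ℕ → ℤ), X₁ ≤ x.natAbs ∧ x ≠ 0 ∧ y 0 = x ∧
      ∀ i ≤ N, |ζ ^ i * x - y i| ≤ (x.natAbs : ℝ) ^ (-l) := by
  let s : Finset ℤ := (Finset.Icc (-(X₁ : ℤ)) X₁).erase 0
  obtain ⟨δ, hδ, hδs⟩ : ∃ δ : ℝ, 0 < δ ∧ ∀ x ∈ s, δ ≤ |ζ * x - round (ζ * x)| := by
    rcases s.eq_empty_or_nonempty with he | hne
    · exact ⟨1, one_pos, by rw [he]; simp⟩
    · obtain ⟨x₀, hx₀, hmin⟩ := Finset.exists_min_image s (fun x : ℤ =>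
        |ζ * x - round (ζ * x)|) hne
      refine ⟨_, abs_pos.mpr ?_, hmin⟩
      exact sub_ne_zero.mpr ((hζ.mul_intCast (Finset.mem_erase.mp hx₀).1).ne_int _)
  obtain ⟨X₂, hX₂⟩ := eventually_atTop.mp
    (((tendsto_rpow_neg_atTop hl).eventually (gt_mem_nhds hδ)).and (eventually_ge_atTop 1))
  obtain ⟨X, hX, x, y, hx1, hxX, hy⟩ := h X₂
  obtain ⟨hXδ, hX1⟩ := hX₂ X hX
  have hx0 : x ≠ 0 := by rintro rfl; simp at hx1
  have hcast : (x.natAbs : ℝ) = |(x : ℝ)| := by rw [Nat.cast_natAbs, Int.cast_abs]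
  have hxpos : (0 : ℝ) < x.natAbs := by exact_mod_cast Int.natAbs_pos.mpr hx0
  have hmono : X ^ (-l) ≤ (x.natAbs : ℝ) ^ (-l) :=
    Real.rpow_le_rpow_of_nonpos hxpos (by rw [hcast]; exact hxX) (by linarith)
  refine ⟨x, fun i => if h : 1 ≤ i ∧ i ≤ N then y ⟨i - 1, by omega⟩ else x, ?_, hx0, by simp,
    fun i hi => ?_⟩
  · by_contra hcon
    have hmem : x ∈ s := Finset.mem_erase.mpr ⟨hx0, Finset.mem_Icc.mpr (by omega)⟩
    have h1 := hδs x hmem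
    have h2 := hy ⟨0, hN⟩
    simp only [zero_add, pow_one] at h2
    have h3 := round_le (ζ * x) (y ⟨0, hN⟩)
    linarith
  · beta_reduce
    rcases Nat.eq_zero_or_pos i with rfl | hi0
    · simp only [pow_zero, one_mul]
      rw [dif_neg (by omega), sub_self, abs_zero]
      exact Real.rpow_nonneg hxpos.le _
    · rw [dif_pos ⟨hi0, hi⟩]
      have := hy ⟨i - 1, by omega⟩
      simp only [Nat.sub_add_cancel hi0] at this
      exact this.trans hmono

/-- Boundedness of `w_k(ζ)` forces `λ_N(ζ) ≤ 1 / k` as soon as `N` exceeds `3 k + w_k(ζ)`. -/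
theorem lambdaExp_le_of_wExp_lt {ζ : ℝ} (hζ : Transcendental ℚ ζ) {k w N : ℕ} (hk : 1 ≤ k)
    (hw : wExp k ζ < ((w : ℝ) : EReal)) (hN : 3 * k + w ≤ N) :
    lambdaExp N ζ ≤ ((1 / (k : ℝ) : ℝ) : EReal) := by
  by_contra! hcon
  obtain ⟨_, ⟨l, hset, rfl⟩, hlt⟩ := lt_sSup_iff.mp hcon
  have hkpos : (0 : ℝ) < k := by exact_mod_cast hk
  have hlk : 1 / (k : ℝ) < l := EReal.coe_lt_coe_iff.mp hlt
  have hl : 0 < l := lt_trans (by positivity) hlk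
  have hlk1 : 0 < l * k - 1 := by
    have := (div_lt_iff₀ hkpos).mp hlk
    linarith
  obtain ⟨c₁, hc₁, hlower⟩ := exists_le_abs_aeval_of_wExp_lt hζ hw
  set A : ℝ := max 1 |ζ| with hAdef
  have hA : 1 ≤ A := le_max_left _ _
  set n := 2 * k + w with hn
  obtain ⟨C₅, hC₅⟩ : ∃ C₅ : ℕ,
    C₅ = (2 * (n + 1) + 1) * (2 * (4 ^ n * (n + 1)) + 1) ^ (n + 1) := ⟨_, rfl⟩
  obtain ⟨Cy, hCy⟩ := exists_nat_ge (A ^ N + 1)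
  set c : ℝ := 1 / (2 * ((N + 1) * (A ^ N + 1))) with hc
  have hcpos : 0 < c := by positivity
  -- all requirements on the size of `X = |x|`
  have hev1 : ∀ᶠ X : ℝ in atTop, 2 ≤ c * X ^ l :=
    ((tendsto_rpow_atTop hl).const_mul_atTop hcpos).eventually_ge_atTop 2
  have hev2 : ∀ᶠ X : ℝ in atTop, C₅ * Cy / (c / 2) ^ k ≤ X ^ (l * k - 1) :=
    (tendsto_rpow_atTop hlk1).eventually_ge_atTop _
  have hev3 : ∀ᶠ X : ℝ in atTop, C₅ * Cy * (N + 1) / c₁ ≤ X ^ l :=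
    (tendsto_rpow_atTop hl).eventually_ge_atTop _
  obtain ⟨X₂, hX₂⟩ := eventually_atTop.mp
    (((hev1.and hev2).and hev3).and (eventually_ge_atTop 1))
  obtain ⟨X₁, hX₁⟩ := exists_nat_ge X₂
  obtain ⟨x, y, hxX, hx0, hy0, hy⟩ := exists_large_approx hζ.irrational hl (by omega) hset X₁
  obtain ⟨⟨⟨h1, h2⟩, h3⟩, h4⟩ := hX₂ x.natAbs (hX₁.trans (by exact_mod_cast hxX))
  set X : ℝ := (x.natAbs : ℝ) with hX
  have hXpos : 0 < X := by linarith
  have hxabs : |(x : ℝ)| = X := by rw [hX, Nat.cast_natAbs, Int.cast_abs]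
  have hLpos : 0 < X ^ l := Real.rpow_pos_of_pos hXpos _
  have hε : X ^ (-l) = (X ^ l)⁻¹ := Real.rpow_neg hXpos.le _
  set B : ℕ := ⌊c * X ^ l⌋₊ with hB
  have hBle : (B : ℝ) ≤ c * X ^ l := Nat.floor_le (by positivity)
  have hBge : c / 2 * X ^ l ≤ B := by
    have := Nat.lt_floor_add_one (c * X ^ l)
    rw [← hB] at this
    linarith
  have hB1 : 1 ≤ B := Nat.one_le_floor_iff _ |>.mpr (by linarith)
  have hsmall : (N + 1) * (A ^ N + 1) * (B * X ^ (-l)) < 1 := by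
    calc (N + 1) * (A ^ N + 1) * (B * X ^ (-l))
        ≤ (N + 1) * (A ^ N + 1) * (c * X ^ l * X ^ (-l)) := by gcongr
      _ = 1 / 2 := by
        rw [hε, hc]
        field_simp
      _ < 1 := by norm_num
  have hyY : ∀ i ≤ N, |y i| ≤ ((Cy * x.natAbs : ℕ) : ℤ) := by
    intro i hi
    have h5 : |ζ ^ i * (x : ℝ)| ≤ A ^ N * X := by
      rw [abs_mul, hxabs, abs_pow]
      gcongr
      exact (pow_le_pow_left₀ (abs_nonneg _) (le_max_right 1 |ζ|) i).trans
        (pow_le_pow_right₀ hA hi)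
    have h6 : X ^ (-l) ≤ 1 := Real.rpow_le_one_of_one_le_of_nonpos h4 (by linarith)
    have h7 : |(y i : ℝ)| ≤ Cy * X := by
      calc |(y i : ℝ)| = |ζ ^ i * (x : ℝ) - (ζ ^ i * (x : ℝ) - y i)| := by
            congr 1
            ring
        _ ≤ A ^ N * X + 1 := (abs_sub _ _).trans (add_le_add h5 ((hy i hi).trans h6))
        _ ≤ (A ^ N + 1) * X := by linarith
        _ ≤ Cy * X := by gcongr
    have h8 : ((|y i| : ℤ) : ℝ) ≤ (((Cy * x.natAbs : ℕ) : ℤ) : ℝ) := by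
      rw [Int.cast_abs, Int.cast_natCast, Nat.cast_mul]
      exact h7
    exact Int.cast_le.mp h8
  have hBk : C₅ * (Cy * x.natAbs) ≤ B ^ k := by
    have : (C₅ * (Cy * X) : ℝ) ≤ (B : ℝ) ^ k := by
      rw [div_le_iff₀ (by positivity)] at h2
      calc (C₅ * (Cy * X) : ℝ) = C₅ * Cy * X := by ring
        _ ≤ X ^ (l * k - 1) * (c / 2) ^ k * X := by gcongr
        _ = (c / 2 * X ^ l) ^ k := by
          rw [mul_pow, ← Real.rpow_natCast (X ^ l) k, ← Real.rpow_mul hXpos.le,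
            Real.rpow_sub_one hXpos.ne']
          field_simp
        _ ≤ (B : ℝ) ^ k := by gcongr
    exact Nat.cast_le (α := ℝ).mp (by rw [Nat.cast_mul, Nat.cast_mul, Nat.cast_pow]; exact this)
  obtain ⟨G, hG0, hGk, hGy, hGH⟩ := exists_annihilator_height_pow_lt (e₀ := k + w + 1) (k := k)
    (n := n) hA (le_max_right 1 |ζ|) (Real.rpow_nonneg hXpos.le (-l)) hx0 hy0 hy hyY hsmall hB1
    (by omega) (by omega) (by omega) (by rw [← hC₅]; exact hBk)
  rw [← hC₅] at hGH
  set H := polyHeight G with hH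
  have hH1 : (1 : ℝ) ≤ H := by exact_mod_cast one_le_polyHeight hG0
  have hGval : X * |Polynomial.aeval ζ G| ≤ (N + 1) * (H * X ^ (-l)) := by
    have h5 := sum_coeff_mul_eq (θ := ζ) hGk x y 0
    simp only [zero_add, hGy, Int.cast_zero, pow_zero, mul_one] at h5
    have h6 := abs_sum_mul_le (n := k + 1) (Nat.cast_nonneg H)
      (fun i => abs_coeff_le_polyHeight G i) (fun i hi => hy i (by omega))
    rw [← sub_eq_zero.mp h5.symm, abs_mul, hxabs] at h6
    refine h6.trans ?_
    have : ((k + 1 : ℕ) : ℝ) ≤ N + 1 := by exact_mod_cast (by omega : k + 1 ≤ N + 1)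
    gcongr
  have hcontra : (C₅ * (Cy * X) : ℝ) ≤ (H : ℝ) ^ (k + w + 1) := by
    have h5 := hlower G hG0 hGk
    rw [div_le_iff₀ hc₁] at h3
    have h6 : c₁ * X ≤ (N + 1) * (H : ℝ) ^ (w + 1) * X ^ (-l) := by
      calc c₁ * X ≤ |Polynomial.aeval ζ G| * (H : ℝ) ^ w * X := by gcongr
        _ = X * |Polynomial.aeval ζ G| * (H : ℝ) ^ w := by ring
        _ ≤ (N + 1) * (H * X ^ (-l)) * (H : ℝ) ^ w := by gcongr
        _ = _ := by ring
    rw [hε, ← div_eq_mul_inv, le_div_iff₀ hLpos] at h6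
    have h7 : (N + 1) * (C₅ * (Cy * X)) ≤ (N + 1) * (H : ℝ) ^ (w + 1) := by
      calc (N + 1) * (C₅ * (Cy * X)) = (C₅ * Cy * (N + 1)) * X := by ring
        _ ≤ X ^ l * c₁ * X := by gcongr
        _ = c₁ * X * X ^ l := by ring
        _ ≤ _ := h6
    refine (le_of_mul_le_mul_left h7 (by positivity)).trans ?_
    exact pow_le_pow_right₀ hH1 (by omega)
  refine absurd (Nat.cast_le (α := ℝ).mp ?_) (not_le.mpr hGH)
  rw [Nat.cast_mul, Nat.cast_mul, Nat.cast_pow]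
  exact hcontra

/-! ### Comparison of the two sequences of exponents -/

theorem lambdaExp_nonneg (n : ℕ) (ζ : ℝ) : 0 ≤ lambdaExp n ζ := by
  rw [← EReal.coe_zero]
  refine le_sSup (Set.mem_image_of_mem _ fun X₀ => ⟨max X₀ 1, le_max_left _ _, 1,
    fun i => round (ζ ^ ((i : ℕ) + 1) * ((1 : ℤ) : ℝ)), by simp, by simp, fun i => ?_⟩)
  rw [neg_zero, Real.rpow_zero]
  exact (abs_sub_round _).trans (by norm_num)

theorem exists_nat_gt_of_lt_top {a : EReal} (h : a < ⊤) : ∃ w : ℕ, a < ((w : ℝ) : EReal) := by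
  obtain ⟨r, hr, -⟩ := EReal.lt_iff_exists_real_btwn.mp h
  obtain ⟨w, hw⟩ := exists_nat_ge r
  exact ⟨w, hr.trans_le (EReal.coe_le_coe_iff.mpr hw)⟩

theorem eq_top_of_forall_nat_le {a : EReal} (h : ∀ M : ℕ, ((M : ℝ) : EReal) ≤ a) : a = ⊤ := by
  by_contra hne
  obtain ⟨w, hw⟩ := exists_nat_gt_of_lt_top (lt_top_iff_ne_top.mpr hne)
  exact (h w).not_gt hw

theorem isUNumber_iff {ζ : ℝ} (hζ : Transcendental ℚ ζ) :
    IsUNumber ζ ↔ ∃ m, 1 ≤ m ∧ wExp m ζ = ⊤ := by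
  classical
  constructor
  · rintro ⟨m, -, hm, hw, -⟩
    exact ⟨m, hm, hw⟩
  · intro h
    refine ⟨Nat.find h, hζ, (Nat.find_spec h).1, (Nat.find_spec h).2, fun k hk hlt htop => ?_⟩
    exact Nat.find_min h hlt ⟨hk, htop⟩

theorem wExp_lt_top_of_not_isUNumber {ζ : ℝ} (hζ : Transcendental ℚ ζ) (h : ¬ IsUNumber ζ)
    {n : ℕ} (hn : 1 ≤ n) : wExp n ζ < ⊤ :=
  lt_top_iff_ne_top.mpr fun htop => h ((isUNumber_iff hζ).mpr ⟨n, hn, htop⟩)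

theorem div_natCast_le_iff {a : EReal} {n : ℕ} (hn : 1 ≤ n) (C : ℝ) :
    a / (n : EReal) ≤ (C : EReal) ↔ a ≤ ((C * n : ℝ) : EReal) := by
  rw [EReal.div_le_iff_le_mul (by exact_mod_cast hn) (EReal.natCast_ne_top n), mul_comm,
    EReal.coe_mul, EReal.coe_natCast]

theorem isSNumber_iff {ζ : ℝ} (hζ : Transcendental ℚ ζ) :
    IsSNumber ζ ↔ ∃ C : ℕ, ∀ n : ℕ, 1 ≤ n → wExp n ζ ≤ ((C * n : ℝ) : EReal) := by
  constructor
  · rintro ⟨-, C, hC⟩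
    obtain ⟨C', hC'⟩ := exists_nat_ge C
    refine ⟨C', fun n hn => ((div_natCast_le_iff hn C).mp (hC n hn)).trans ?_⟩
    exact EReal.coe_le_coe_iff.mpr (by gcongr)
  · rintro ⟨C, hC⟩
    exact ⟨hζ, C, fun n hn => (div_natCast_le_iff hn C).mpr (hC n hn)⟩

/-- If all `w_n(ζ)` are finite and `ζ` is not an `S`-number, then `w_n(ζ) / n` is large for
arbitrarily large `n`, since finitely many finite values do not affect boundedness. -/
theorem exists_lt_wExp_of_not_isSNumber {ζ : ℝ} (hζ : Transcendental ℚ ζ) (hS : ¬ IsSNumber ζ)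
    (hfin : ∀ n : ℕ, 1 ≤ n → wExp n ζ < ⊤) (K n₀ : ℕ) :
    ∃ n, n₀ ≤ n ∧ 1 ≤ n ∧ ((K * n : ℝ) : EReal) < wExp n ζ := by
  by_contra! hcon
  refine hS ((isSNumber_iff hζ).mpr ?_)
  have hW : ∀ n : ℕ, ∃ w : ℕ, 1 ≤ n → wExp n ζ < ((w : ℝ) : EReal) := by
    intro n
    by_cases hn : 1 ≤ n
    · obtain ⟨w, hw⟩ := exists_nat_gt_of_lt_top (hfin n hn)
      exact ⟨w, fun _ => hw⟩
    · exact ⟨0, fun h => absurd h hn⟩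
  choose W hW using hW
  refine ⟨K + ∑ n ∈ Finset.range n₀, W n, fun n hn => ?_⟩
  have hn' : (1 : ℝ) ≤ n := by exact_mod_cast hn
  rcases le_or_gt n₀ n with h | h
  · refine (hcon n h hn).trans (EReal.coe_le_coe_iff.mpr ?_)
    gcongr
    simp
  · refine (hW n hn).le.trans (EReal.coe_le_coe_iff.mpr ?_)
    have h1 : W n ≤ K + ∑ n ∈ Finset.range n₀, W n :=
      (Finset.single_le_sum (f := W) (fun _ _ => Nat.zero_le _) (Finset.mem_range.mpr h)).trans
        (Nat.le_add_left _ _)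
    calc (W n : ℝ) ≤ ((K + ∑ n ∈ Finset.range n₀, W n : ℕ) : ℝ) := by exact_mod_cast h1
      _ ≤ _ := le_mul_of_one_le_right (Nat.cast_nonneg _) hn'

theorem eventually_lambdaExp_eq {ζ : ℝ} {m : ℕ} (h : IsUNumberOfType m ζ) :
    ∀ᶠ n : ℕ in atTop,
      lambdaExp n ζ = if m = 1 then ⊤ else ((1 / ((m : ℝ) - 1) : ℝ) : EReal) := by
  obtain ⟨hζ, hm, hw, hlt⟩ := h
  split_ifs with h1
  · subst h1
    filter_upwards [eventually_ge_atTop 1] with n hn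
    exact eq_top_of_forall_nat_le fun M => le_lambdaExp_of_wExp_eq_top le_rfl hn hw (by simp)
  · obtain ⟨k, rfl⟩ := Nat.exists_eq_add_of_le' hm
    have hk : 1 ≤ k := by omega
    have hkpos : (0 : ℝ) < k := by exact_mod_cast hk
    obtain ⟨w, hwk⟩ := exists_nat_gt_of_lt_top
      (lt_top_iff_ne_top.mpr (hlt k hk (Nat.lt_succ_self k)))
    filter_upwards [eventually_ge_atTop (3 * k + w)] with n hn
    rw [Nat.cast_add_one, add_sub_cancel_right]
    refine le_antisymm (lambdaExp_le_of_wExp_lt hζ hk hwk hn) ?_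
    by_contra! hcon
    obtain ⟨l, hl1, hl2⟩ := EReal.lt_iff_exists_real_btwn.mp hcon
    refine hl1.not_ge (le_lambdaExp_of_wExp_eq_top hm (by omega) hw ?_)
    rw [Nat.cast_add_one, add_sub_cancel_right]
    exact (lt_div_iff₀ hkpos).mp (EReal.coe_lt_coe_iff.mp hl2)

theorem tendsto_lambdaExp_zero {ζ : ℝ} (hζ : Transcendental ℚ ζ)
    (hfin : ∀ n : ℕ, 1 ≤ n → wExp n ζ < ⊤) :
    Tendsto (fun n : ℕ => lambdaExp n ζ) atTop (𝓝 0) := by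
  refine tendsto_order.mpr ⟨fun a ha => Eventually.of_forall fun n =>
    ha.trans_le (lambdaExp_nonneg n ζ), fun b hb => ?_⟩
  obtain ⟨r, hr0, hrb⟩ := EReal.lt_iff_exists_real_btwn.mp hb
  obtain ⟨k, hk⟩ := exists_nat_one_div_lt (EReal.coe_pos.mp hr0)
  obtain ⟨w, hw⟩ := exists_nat_gt_of_lt_top (hfin (k + 1) (by omega))
  filter_upwards [eventually_ge_atTop (3 * (k + 1) + w)] with n hn
  refine (lambdaExp_le_of_wExp_lt hζ (by omega) hw hn).trans_lt (lt_trans ?_ hrb)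
  exact EReal.coe_lt_coe_iff.mpr (by exact_mod_cast hk)

theorem isUNumber_iff_exists_tendsto {ζ : ℝ} (hζ : Transcendental ℚ ζ) :
    IsUNumber ζ ↔
      ∃ L : EReal, 0 < L ∧ Tendsto (fun n : ℕ => lambdaExp n ζ) atTop (𝓝 L) := by
  constructor
  · rintro ⟨m, hm⟩
    refine ⟨_, ?_, tendsto_const_nhds.congr'
      ((eventually_lambdaExp_eq hm).mono fun n hn => hn.symm)⟩
    split_ifs with h1
    · exact EReal.zero_lt_top
    · have : (2 : ℝ) ≤ m := by exact_mod_cast (by have := hm.2.1; omega : 2 ≤ m)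
      exact EReal.coe_pos.mpr (one_div_pos.mpr (by linarith))
  · rintro ⟨L, hL, hlim⟩
    by_contra hU
    exact hL.ne (tendsto_nhds_unique
      (tendsto_lambdaExp_zero hζ fun n hn => wExp_lt_top_of_not_isUNumber hζ hU hn) hlim)

theorem coe_mul_le_natCast_mul {n : ℕ} {r : ℝ} {a : EReal} (h : (r : EReal) ≤ a) :
    ((n * r : ℝ) : EReal) ≤ (n : EReal) * a := by
  rw [EReal.coe_mul, EReal.coe_natCast]
  exact mul_le_mul_of_nonneg_left h (by exact_mod_cast Nat.zero_le n)

theorem limsup_eq_top_of_frequently {u : ℕ → EReal}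
    (h : ∀ M n₀ : ℕ, ∃ n, n₀ ≤ n ∧ ((M : ℝ) : EReal) ≤ u n) : limsup u atTop = ⊤ :=
  eq_top_of_forall_nat_le fun M =>
    le_limsup_of_frequently_le (frequently_atTop.mpr fun n₀ => h M n₀)

theorem limsup_mul_lambdaExp_eq_top {ζ : ℝ} (hζ : Transcendental ℚ ζ) (hS : ¬ IsSNumber ζ) :
    limsup (fun n : ℕ => (n : EReal) * lambdaExp n ζ) atTop = ⊤ := by
  refine limsup_eq_top_of_frequently fun M n₀ => ?_
  by_cases hU : IsUNumber ζ
  · obtain ⟨m, hm, hw⟩ := (isUNumber_iff hζ).mp hU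
    have hmpos : (0 : ℝ) < m := by exact_mod_cast hm
    refine ⟨n₀ + m * (M + 1), by omega, ?_⟩
    have h1 := le_lambdaExp_of_wExp_eq_top (l := 1 / m) (N := n₀ + m * (M + 1)) hm (by nlinarith)
      hw (by rw [one_div_mul_eq_div, div_lt_one hmpos]; linarith)
    refine le_trans (EReal.coe_le_coe_iff.mpr ?_) (coe_mul_le_natCast_mul h1)
    rw [mul_one_div, le_div_iff₀ hmpos]
    push_cast
    nlinarith [Nat.cast_nonneg (α := ℝ) n₀]
  · set a := 4 * M + 1 with ha
    obtain ⟨n, hn₀, hn, hlt⟩ := exists_lt_wExp_of_not_isSNumber hζ hS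
      (fun n hn => wExp_lt_top_of_not_isUNumber hζ hU hn) (3 * a + 1) n₀
    have hnpos : (0 : ℝ) < n := by exact_mod_cast hn
    refine ⟨(a + 1) * n, hn₀.trans (Nat.le_mul_of_pos_left n (by omega)), ?_⟩
    have h1 := le_lambdaExp_of_lt_wExp (ζ := ζ) hn (by omega : 1 ≤ a) (by exact_mod_cast hlt)
    refine le_trans (EReal.coe_le_coe_iff.mpr ?_) (coe_mul_le_natCast_mul h1)
    rw [mul_one_div, le_div_iff₀ (by positivity), ha]
    push_cast
    nlinarith

theorem limsup_mul_lambdaExp_lt_top {ζ : ℝ} (hS : IsSNumber ζ) :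
    limsup (fun n : ℕ => (n : EReal) * lambdaExp n ζ) atTop < ⊤ := by
  have hζ := hS.1
  obtain ⟨C, hC⟩ := (isSNumber_iff hζ).mp hS
  suffices hle : limsup (fun n : ℕ => (n : EReal) * lambdaExp n ζ) atTop ≤
      ((2 * (C + 4) : ℝ) : EReal) from hle.trans_lt (EReal.coe_lt_top _)
  refine limsup_le_of_le (by isBoundedDefault) ?_
  filter_upwards [eventually_ge_atTop (C + 4)] with N hN
  set k := N / (C + 4) with hk
  have hk1 : 1 ≤ k := (Nat.one_le_div_iff (by omega)).mpr hN
  have hkpos : (0 : ℝ) < k := by exact_mod_cast hk1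
  have hle : k * (C + 4) ≤ N := Nat.div_mul_le_self _ _
  have hlt : N < (k + 1) * (C + 4) := by
    rw [mul_comm]
    exact Nat.lt_mul_div_succ N (by omega)
  have h1 : lambdaExp N ζ ≤ ((1 / (k : ℝ) : ℝ) : EReal) := by
    refine lambdaExp_le_of_wExp_lt hζ (w := C * k + 1) hk1
      ((hC k hk1).trans_lt (EReal.coe_lt_coe_iff.mpr ?_)) (by nlinarith)
    push_cast
    linarith
  calc (N : EReal) * lambdaExp N ζ ≤ (N : EReal) * ((1 / (k : ℝ) : ℝ) : EReal) :=
        mul_le_mul_of_nonneg_left h1 (by exact_mod_cast Nat.zero_le N)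
    _ = ((N * (1 / (k : ℝ)) : ℝ) : EReal) := by rw [EReal.coe_mul, EReal.coe_natCast]
    _ ≤ _ := by
      refine EReal.coe_le_coe_iff.mpr ?_
      rw [mul_one_div, div_le_iff₀ hkpos]
      have h2 : (N : ℝ) ≤ (k + 1) * (C + 4) := by exact_mod_cast hlt.le
      have h3 : (1 : ℝ) ≤ k := by exact_mod_cast hk1
      nlinarith [Nat.cast_nonneg (α := ℝ) C]

theorem isSNumber_iff_limsup_lt_top {ζ : ℝ} (hζ : Transcendental ℚ ζ) :
    IsSNumber ζ ↔ limsup (fun n : ℕ => (n : EReal) * lambdaExp n ζ) atTop < ⊤ := by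
  refine ⟨limsup_mul_lambdaExp_lt_top, fun h => ?_⟩
  by_contra hS
  exact h.ne (limsup_mul_lambdaExp_eq_top hζ hS)

theorem limsup_wExp_div_eq_top_iff {ζ : ℝ} (hζ : Transcendental ℚ ζ)
    (hfin : ∀ n : ℕ, 1 ≤ n → wExp n ζ < ⊤) :
    limsup (fun n : ℕ => wExp n ζ / (n : EReal)) atTop = ⊤ ↔ ¬ IsSNumber ζ := by
  constructor
  · rintro h ⟨-, C, hC⟩
    have hle : limsup (fun n : ℕ => wExp n ζ / (n : EReal)) atTop ≤ (C : EReal) :=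
      limsup_le_of_le (by isBoundedDefault) ((eventually_ge_atTop 1).mono hC)
    rw [h] at hle
    exact (EReal.coe_lt_top C).not_ge hle
  · refine fun hS => limsup_eq_top_of_frequently fun M n₀ => ?_
    obtain ⟨n, hn₀, hn, hlt⟩ := exists_lt_wExp_of_not_isSNumber hζ hS hfin M n₀
    exact ⟨n, hn₀, (not_le.mp fun h => hlt.not_ge ((div_natCast_le_iff hn M).mp h)).le⟩

theorem isTNumber_iff {ζ : ℝ} (hζ : Transcendental ℚ ζ) :
    IsTNumber ζ ↔ Tendsto (fun n : ℕ => lambdaExp n ζ) atTop (𝓝 0) ∧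
      limsup (fun n : ℕ => (n : EReal) * lambdaExp n ζ) atTop = ⊤ := by
  constructor
  · rintro ⟨-, hfin, hsup⟩
    exact ⟨tendsto_lambdaExp_zero hζ hfin,
      limsup_mul_lambdaExp_eq_top hζ ((limsup_wExp_div_eq_top_iff hζ hfin).mp hsup)⟩
  · rintro ⟨hlim, hsup⟩
    have hU : ¬ IsUNumber ζ := by
      intro hU
      obtain ⟨L, hL, hlim'⟩ := (isUNumber_iff_exists_tendsto hζ).mp hU
      exact hL.ne (tendsto_nhds_unique hlim hlim')
    have hfin : ∀ n : ℕ, 1 ≤ n → wExp n ζ < ⊤ := fun n hn =>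
      wExp_lt_top_of_not_isUNumber hζ hU hn
    exact ⟨hζ, hfin, (limsup_wExp_div_eq_top_iff hζ hfin).mpr fun hS =>
      (limsup_mul_lambdaExp_lt_top hS).ne hsup⟩

theorem theorem2p1 (ζ : ℝ) (hζ : Transcendental ℚ ζ) :
    (IsUNumber ζ ↔
      ∃ L : EReal, 0 < L ∧ Tendsto (fun n : ℕ => lambdaExp n ζ) atTop (𝓝 L)) ∧
    (∀ m : ℕ, IsUNumberOfType m ζ →
      ∀ᶠ n : ℕ in atTop,
        lambdaExp n ζ = if m = 1 then ⊤ else ((1 / ((m : ℝ) - 1) : ℝ) : EReal)) ∧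
    (IsTNumber ζ ↔
      Tendsto (fun n : ℕ => lambdaExp n ζ) atTop (𝓝 0) ∧
        limsup (fun n : ℕ => (n : EReal) * lambdaExp n ζ) atTop = ⊤) ∧
    (IsSNumber ζ ↔
      limsup (fun n : ℕ => (n : EReal) * lambdaExp n ζ) atTop < ⊤) :=
  ⟨isUNumber_iff_exists_tendsto hζ, fun _ hm => eventually_lambdaExp_eq hm, isTNumber_iff hζ,
    isSNumber_iff_limsup_lt_top hζ⟩
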